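/- Let $d\ge 2$ and let $f=[P:Q:R]:\mathbf{P}^2\to\mathbf{P}^2$ be a holomorphic self-map of the complex projective plane of algebraic degree $d$, i.e. $P,Q,R\in\mathbb{C}[z,w,t]$ are homogeneous of degree $d$ with no nontrivial common zero. For $p\in\mathbf{P}^2$ and $n\ge 0$, in local coordinates centred at $p$ and at $f^n(p)$, let $c(p,f^n)$ be the largest integer $c$ such that $|f^n(\zeta)|\le A|\zeta|^{c}$ near $0$ for some constant $A$, and let $\mu(p,Jf^n)$ be the order of vanishing at $p$ of the Jacobian determinant of $f^n$. Put $$c_\infty(p)=\lim_{n\to\infty}c(p,f^n)^{1/n},\qquad \mu_\infty(p)=\lim_{n\to\infty}\bigl(3+2\mu(p,Jf^n)\bigr)^{1/n}.$$ Let $\mathcal{E}_1$ be the union of the irreducible algebraic curves $V\subset\mathbf{P}^2$ such that $\mu_\infty=d$ at every point of $V$, and let $\mathcal{E}_2=\{p\in\mathbf{P}^2: c_\infty(p)=d\}$. A point $q$ is called homogeneous if $f$ maps the pencil of lines through $q$ to the pencil of lines through $f(q)$, i.e. $f$ maps every line through $q$ into a line through $f(q)$. Let $\mathrm{Vol}$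 be the Fubini–Study volume on $\mathbf{P}^2$, normalized to have total mass $1$. Assume that every point of $\mathcal{E}_2\setminus\mathcal{E}_1$ is homogeneous, and let $p\in\mathcal{E}_2$. Then there is a neighborhood $\Omega$ of $p$ such that for every Borel set $E\subset\Omega$ with $\mathrm{Vol}(E)>0$ there exists $\gamma(E)>0$ with $$\mathrm{Vol}(f^nE)\ \ge\ \gamma(E)^{d^n}\qquad\text{for all } n\ge 0 .$$ -/

import Mathlib

open Filter Topology

namespace HolP2

/-- The complex projective plane. -/
abbrev P2 : Type := Projectivization ℂ (Fin 3 → ℂ)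

/-- The quotient topology from the nonzero vectors of the three-dimensional space. -/
noncomputable instance : TopologicalSpace P2 :=
  TopologicalSpace.coinduced
    (fun v : {v : Fin 3 → ℂ // v ≠ 0} => (Projectivization.mk' ℂ v : P2)) inferInstance

noncomputable instance : MeasurableSpace P2 := borel P2

instance : BorelSpace P2 := ⟨rfl⟩

/-! ### Affine charts -/

/-- The affine coordinates `(x_j / x_i)_{j ≠ i}` on the open set `x_i ≠ 0`. The value does not
depend on the representative. -/
noncomputable def affineCoord (i : Fin 3) (p : P2) : Fin 2 → ℂ :=
  fun j => p.rep (i.succAbove j) / p.rep i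

theorem insertNth_one_ne_zero (i : Fin 3) (ζ : Fin 2 → ℂ) :
    (i.insertNth (1 : ℂ) ζ : Fin 3 → ℂ) ≠ 0 := by
  intro h
  have := congrFun h i
  simp at this

/-- The inverse of `affineCoord i`: the coordinate number `i` is put equal to `1`. -/
noncomputable def affinePoint (i : Fin 3) (ζ : Fin 2 → ℂ) : P2 :=
  Projectivization.mk ℂ (i.insertNth (1 : ℂ) ζ : Fin 3 → ℂ) (insertNth_one_ne_zero i ζ)

theorem affineCoord_mk (i : Fin 3) (v : Fin 3 → ℂ) (hv : v ≠ 0) :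
    affineCoord i (Projectivization.mk ℂ v hv) = fun j => v (i.succAbove j) / v i := by
  obtain ⟨a, ha⟩ := Projectivization.exists_smul_eq_mk_rep ℂ v hv
  funext j
  have ha0 : (a : ℂ) ≠ 0 := a.ne_zero
  simp only [affineCoord, ← ha, Units.smul_def, Pi.smul_apply, smul_eq_mul]
  rw [mul_div_mul_left _ _ ha0]

theorem affineCoord_affinePoint (i : Fin 3) (ζ : Fin 2 → ℂ) :
    affineCoord i (affinePoint i ζ) = ζ := by
  rw [affinePoint, affineCoord_mk]
  funext j
  simp

theorem continuous_affinePoint (i : Fin 3) : Continuous (affinePoint i) := by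
  have h1 : Continuous
      (fun v : {v : Fin 3 → ℂ // v ≠ 0} => (Projectivization.mk' ℂ v : P2)) :=
    continuous_coinduced_rng
  have h2 : Continuous (fun ζ : Fin 2 → ℂ => (i.insertNth (1 : ℂ) ζ : Fin 3 → ℂ)) := by
    fun_prop
  exact h1.comp (h2.subtype_mk (insertNth_one_ne_zero i))

theorem exists_rep_ne_zero (p : P2) : ∃ i : Fin 3, p.rep i ≠ 0 := by
  by_contra! h
  exact p.rep_nonzero (funext h)

/-- The index of an affine chart around `p`. -/
noncomputable def chartIndex (p : P2) : Fin 3 := (exists_rep_ne_zero p).choose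

/-- The expression of `g : P2 → P2` in affine coordinates around `p` and `g p`, both translated
so that `p` and `g p` become the origin. -/
noncomputable def localExpr (g : P2 → P2) (p : P2) (ζ : Fin 2 → ℂ) : Fin 2 → ℂ :=
  affineCoord (chartIndex (g p))
      (g (affinePoint (chartIndex p) (ζ + affineCoord (chartIndex p) p)))
    - affineCoord (chartIndex (g p)) (g p)

/-! ### Multiplicities -/

/-- The order of vanishing at the origin: the largest integer `k` such that
`‖F ζ‖ ≤ A * ‖ζ‖ ^ k` near `0` for some constant `A`. For a holomorphic `F` that is not
identically zero near `0` this is the order of its first nonzero Taylor term. -/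
noncomputable def vanishingOrder {W : Type*} [NormedAddCommGroup W] (F : (Fin 2 → ℂ) → W) : ℕ :=
  sSup {k : ℕ | F =O[𝓝 0] fun ζ => ‖ζ‖ ^ k}

/-- The multiplicity `c(p, g)`. -/
noncomputable def mult (g : P2 → P2) (p : P2) : ℕ := vanishingOrder (localExpr g p)

/-- The multiplicity `μ(p, Jg)`: the order of vanishing at `p` of the complex Jacobian determinant
of `g` in local charts. -/
noncomputable def jacMult (g : P2 → P2) (p : P2) : ℕ :=
  vanishingOrder fun ζ => (fderiv ℂ (localExpr g p) ζ).det

/-! ### Holomorphic self-maps of the projective plane -/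

/-- A holomorphic self-map of algebraic degree `d` of the projective plane, in homogeneous
coordinates: three homogeneous polynomials of degree `d` with no nontrivial common zero. -/
structure HolMap (d : ℕ) where
  poly : Fin 3 → MvPolynomial (Fin 3) ℂ
  homogeneous : ∀ i, (poly i).IsHomogeneous d
  no_common_zero : ∀ v : Fin 3 → ℂ, (∀ i, MvPolynomial.eval v (poly i) = 0) → v = 0

variable {d : ℕ}

theorem HolMap.eval_ne_zero (f : HolMap d) (v : Fin 3 → ℂ) (hv : v ≠ 0) :
    (fun i => MvPolynomial.eval v (f.poly i)) ≠ 0 :=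
  fun h => hv (f.no_common_zero v fun i => congrFun h i)

/-- The map of the projective plane given by `f`. -/
noncomputable def HolMap.map (f : HolMap d) (p : P2) : P2 :=
  Projectivization.mk ℂ (fun i => MvPolynomial.eval p.rep (f.poly i))
    (f.eval_ne_zero p.rep p.rep_nonzero)

theorem eval_smul_of_isHomogeneous {P : MvPolynomial (Fin 3) ℂ} (hP : P.IsHomogeneous d)
    (a : ℂ) (v : Fin 3 → ℂ) :
    MvPolynomial.eval (a • v) P = a ^ d * MvPolynomial.eval v P := by
  rw [MvPolynomial.eval_eq, MvPolynomial.eval_eq, Finset.mul_sum]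
  refine Finset.sum_congr rfl fun m hm => ?_
  have hdeg : ∑ i ∈ m.support, m i = d := by
    have := hP (MvPolynomial.mem_support_iff.mp hm)
    simpa [Finsupp.weight_apply, Finsupp.sum] using this
  simp only [Pi.smul_apply, smul_eq_mul, mul_pow, Finset.prod_mul_distrib,
    Finset.prod_pow_eq_pow_sum, hdeg]
  ring

/-- The value of the map may be computed with any representative. -/
theorem HolMap.map_mk (f : HolMap d) (v : Fin 3 → ℂ) (hv : v ≠ 0) :
    f.map (Projectivization.mk ℂ v hv) =
      Projectivization.mk ℂ (fun i => MvPolynomial.eval v (f.poly i)) (f.eval_ne_zero v hv) := by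
  obtain ⟨a, ha⟩ := Projectivization.exists_smul_eq_mk_rep ℂ v hv
  rw [HolMap.map, Projectivization.mk_eq_mk_iff']
  refine ⟨(a : ℂ) ^ d, ?_⟩
  funext i
  rw [← ha, Units.smul_def, eval_smul_of_isHomogeneous (f.homogeneous i)]
  simp

/-- An irreducible plane curve: the zero locus of an irreducible homogeneous polynomial. -/
def IsIrreducibleCurve (V : Set P2) : Prop :=
  ∃ (k : ℕ) (Φ : MvPolynomial (Fin 3) ℂ), Φ.IsHomogeneous k ∧ Irreducible Φ ∧
    V = {p : P2 | MvPolynomial.eval p.rep Φ = 0}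

/-- A projective line: the points lying in a two-dimensional linear subspace. -/
def IsLine (L : Set P2) : Prop :=
  ∃ W : Submodule ℂ (Fin 3 → ℂ), Module.finrank ℂ W = 2 ∧ L = {p : P2 | p.submodule ≤ W}

/-- The asymptotic multiplicity `c_∞(p) = lim c(p, f^n)^{1/n}` exists and equals `l`. -/
def HolMap.HasAsympMult (f : HolMap d) (p : P2) (l : ℝ) : Prop :=
  Tendsto (fun n : ℕ => (mult f.map^[n] p : ℝ) ^ (1 / (n : ℝ))) atTop (𝓝 l)

/-- The asymptotic multiplicity of the Jacobian
`μ_∞(p) = lim (3 + 2 μ(p, J f^n))^{1/n}` exists and equals `l`. -/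
def HolMap.HasAsympJacMult (f : HolMap d) (p : P2) (l : ℝ) : Prop :=
  Tendsto (fun n : ℕ => (3 + 2 * (jacMult f.map^[n] p : ℝ)) ^ (1 / (n : ℝ))) atTop (𝓝 l)

/-- The first exceptional set: the union of the irreducible curves on which `μ_∞ = d`. -/
def HolMap.excOne (f : HolMap d) : Set P2 :=
  ⋃₀ {V : Set P2 | IsIrreducibleCurve V ∧ ∀ p ∈ V, f.HasAsympJacMult p d}

/-- The second exceptional set: the points with `c_∞ = d`. -/
def HolMap.excTwo (f : HolMap d) : Set P2 :=
  {p : P2 | f.HasAsympMult p d}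

/-- `p` is a homogeneous point: `f` maps the pencil of lines through `p` to the pencil of lines
through `f p`. -/
def HolMap.IsHomogeneousPoint (f : HolMap d) (p : P2) : Prop :=
  ∀ L : Set P2, IsLine L → p ∈ L → ∃ L' : Set P2, IsLine L' ∧ f.map p ∈ L' ∧ f.map '' L ⊆ L'

/-! ### Volume -/

/-- The Fubini-Study volume, normalized to have total mass one. In the affine chart
`(ζ₀, ζ₁) ↦ [ζ₀ : ζ₁ : 1]`, whose complement is negligible, its density with respect to Lebesgue
measure is `2 / (π² (1 + |ζ₀|² + |ζ₁|²)³)`. -/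
noncomputable def fsVolume : MeasureTheory.Measure P2 :=
  ((MeasureTheory.volume : MeasureTheory.Measure (Fin 2 → ℂ)).withDensity fun ζ =>
    ENNReal.ofReal (2 / (Real.pi ^ 2 * (1 + ∑ j, ‖ζ j‖ ^ 2) ^ 3))).map (affinePoint (Fin.last 2))

end HolP2

/-!
The estimate holds on the whole plane: every Borel set `E` of positive volume satisfies
`Vol (f^n E) ≥ γ ^ (d ^ n)` for some `γ > 0` depending on `E`, so the neighborhood can be the
plane itself. The reason is that the logarithm of the Jacobian of `f^n` has mean at least
`- C d ^ n` over any bounded region, which is a mean value property of plurisubharmonic functions.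

The argument is carried out for the homogeneous lift `F : ℂ³ → ℂ³` of `f`, with Jacobian
determinant `J`, and Lebesgue measure.

* Each function `log |J ∘ F^i|` is plurisubharmonic. Since `F` is surjective, by Krull's height
  theorem (`HolMap.lift_surjective`), Sard's theorem gives a point `y` with `J y ≠ 0`, and `y` has
  a preimage under `F^i` that stays in a fixed ball (`HolMap.exists_norm_le_of_iterate_eq`). There
  `log |J ∘ F^i|` has the value `log |J y|`, while it is at most `O(d ^ i)` on a large ball. The mean
  value inequality at this point, which comes from Jensen's formula on complex lines
  (`integral_sub_log_max_le`), bounds the integral of `- log |J ∘ F^i|` over a ball by `O(d ^ i)`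
  (`HolMap.exists_integral_orbitJac_le`).
* The complex Jacobian of `F^n` is the product of the `J ∘ F^i` with `i < n`. Summing the integral
  bounds, and using Markov's inequality, at least half of a bounded set of positive measure lies
  where this Jacobian is at least `exp (- τ d ^ n)` (`HolMap.exists_subset_le_norm_det`).
* The fibres of `F` have at most `N` points, by the Nullstellensatz
  (`HolMap.exists_encard_fibre_le`), so those of `F^n` have at most `N ^ n` points, and the change of
  variables formula bounds the volume of the image from below up to the factor `N ^ n`
  (`lintegral_abs_det_fderiv_le_mul_measure_image`).
* The Fubini-Study volume of a set is comparable to the Lebesgue measure of the cone over it in a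
  ball (`volume_cone_pos`, `volume_cone_inter_closedBall_le`), and `F^n` maps a fixed ball into a
  ball of radius `Q ^ (d ^ n)`. This transfers the estimate to the plane.
-/

namespace HolP2

variable {d : ℕ}

/-! ### Fibres and surjectivity of the homogeneous lift -/

/-- The lift of `f` to a self-map of the three-dimensional space. -/
noncomputable def HolMap.lift (f : HolMap d) (v : Fin 3 → ℂ) : Fin 3 → ℂ :=
  fun i => MvPolynomial.eval v (f.poly i)

theorem HolMap.lift_smul (f : HolMap d) (a : ℂ) (v : Fin 3 → ℂ) :
    f.lift (a • v) = a ^ d • f.lift v := by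
  funext i
  simp [HolMap.lift, eval_smul_of_isHomogeneous (f.homogeneous i)]

theorem HolMap.lift_zero (f : HolMap d) (hd : d ≠ 0) : f.lift 0 = 0 := by
  have := f.lift_smul 0 0
  simpa [hd] using this

open MvPolynomial in
/-- By the Nullstellensatz, a power of the ideal of the origin is contained in the ideal of the
components of the lift. -/
theorem HolMap.exists_pow_idealOfVars_le (f : HolMap d) :
    ∃ k, idealOfVars (Fin 3) ℂ ^ k ≤ Ideal.span (Set.range f.poly) := by
  apply Ideal.exists_pow_le_of_le_radical_of_fg _ (idealOfVars_fg _ _)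
  rw [← vanishingIdeal_zeroLocus_eq_radical (K := ℂ), idealOfVars, Ideal.span_le]
  rintro _ ⟨i, rfl⟩ x hx
  have hx0 : x = 0 := f.no_common_zero x fun j => by
    simpa using hx (f.poly j) (Ideal.subset_span ⟨j, rfl⟩)
  simp [hx0]

open MvPolynomial in
attribute [local instance] MvPolynomial.gradedAlgebra in
theorem homogeneousComponent_mul_of_isHomogeneous {σ R : Type*} [CommRing R] {e : ℕ}
    (g : MvPolynomial σ R) {P : MvPolynomial σ R} (hP : P.IsHomogeneous d) (h : d ≤ e) :
    homogeneousComponent e (g * P) = homogeneousComponent (e - d) g * P := by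
  have := DirectSum.coe_decompose_mul_of_right_mem_of_le (homogeneousSubmodule σ R) (a := g)
    (b := P) (i := d) (n := e) hP h
  rw [← decomposition.decompose'_apply, ← decomposition.decompose'_apply]
  exact this

open MvPolynomial in
/-- A linear functional on polynomials that is an eigenvector for the multiplication by each
component of the lift is determined by its values on finitely many monomials. -/
theorem HolMap.functional_eq_zero (f : HolMap d) (hd : d ≠ 0) {k : ℕ} (hdk : d ≤ k)
    (hk : idealOfVars (Fin 3) ℂ ^ k ≤ Ideal.span (Set.range f.poly))
    (L : MvPolynomial (Fin 3) ℂ →ₗ[ℂ] ℂ) (a : Fin 3 → ℂ)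
    (hL : ∀ g i, L (g * f.poly i) = a i * L g)
    (h0 : ∀ m : Fin 3 →₀ ℕ, m.degree < k → L (monomial m 1) = 0) : L = 0 := by
  have key : ∀ (e : ℕ) (p : MvPolynomial (Fin 3) ℂ), p.IsHomogeneous e → L p = 0 := by
    intro e
    induction e using Nat.strong_induction_on with
    | _ e ih =>
      intro p hp
      have hdeg : ∀ m ∈ p.support, m.degree = e := fun m hm => by
        have := hp (mem_support_iff.mp hm)
        rwa [Finsupp.degree_eq_weight_one]
      rcases lt_or_ge e k with he | he
      · rw [p.as_sum, map_sum]
        refine Finset.sum_eq_zero fun m hm => ?_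
        have : monomial m (coeff m p) = coeff m p • monomial m (1 : ℂ) := by
          rw [smul_monomial, smul_eq_mul, mul_one]
        rw [this, map_smul, h0 m (by rw [hdeg m hm]; exact he), smul_zero]
      · have hpI : p ∈ Ideal.span (Set.range f.poly) :=
          hk ((mem_pow_idealOfVars_iff ..).2 fun m hm => by rw [hdeg m hm]; exact he)
        -- The coefficients `g i` may be taken homogeneous of the lower degree `e - d`.
        obtain ⟨g, hg⟩ := (Ideal.mem_span_range_iff_exists_fun).1 hpI
        have hp' : p = ∑ i, homogeneousComponent (e - d) (g i) * f.poly i := by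
          conv_lhs => rw [← homogeneousComponent_eq_self hp, ← hg, map_sum]
          exact Finset.sum_congr rfl fun i _ =>
            homogeneousComponent_mul_of_isHomogeneous _ (f.homogeneous i) (hdk.trans he)
        rw [hp', map_sum]
        refine Finset.sum_eq_zero fun i _ => ?_
        rw [hL, ih (e - d) (by omega) _ (homogeneousComponent_isHomogeneous _ _), mul_zero]
  refine LinearMap.ext fun p => ?_
  rw [← sum_homogeneousComponent p, map_sum]
  exact Finset.sum_eq_zero fun e _ => key e _ (homogeneousComponent_isHomogeneous _ _)

open MvPolynomial in
/-- The fibres of the lift have uniformly bounded cardinality: evaluations at distinct points are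
linearly independent functionals, and those at points of one fibre live in a space of dimension
the number of monomials of bounded degree. -/
theorem HolMap.exists_encard_fibre_le (f : HolMap d) (hd : d ≠ 0) :
    ∃ N : ℕ, ∀ y, (f.lift ⁻¹' {y}).encard ≤ N := by
  obtain ⟨k₀, hk₀⟩ := f.exists_pow_idealOfVars_le
  obtain ⟨k, hdk, hk⟩ : ∃ k, d ≤ k ∧
      idealOfVars (Fin 3) ℂ ^ k ≤ Ideal.span (Set.range f.poly) :=
    ⟨max d k₀, le_max_left _ _, (Ideal.pow_le_pow_right (le_max_right _ _)).trans hk₀⟩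
  have hfin : {m : Fin 3 →₀ ℕ | m.degree < k}.Finite := Finsupp.finite_of_degree_lt k
  refine ⟨hfin.toFinset.card, fun y => ?_⟩
  have key : ∀ t : Finset (Fin 3 → ℂ), (t : Set (Fin 3 → ℂ)) ⊆ f.lift ⁻¹' {y} →
      t.card ≤ hfin.toFinset.card := by
    intro t ht
    let ev : (Fin 3 → ℂ) → (MvPolynomial (Fin 3) ℂ →ₗ[ℂ] ℂ) := fun x => (aeval x).toLinearMap
    have hev : ∀ x p, ev x p = eval x p := fun x p => by simp [ev, aeval_eq_eval]
    let Φ : (t → ℂ) →ₗ[ℂ] (hfin.toFinset → ℂ) :=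
      { toFun := fun c m => ∑ x, c x * eval x.1 (monomial m.1 1)
        map_add' := fun c c' => by
          funext m; simp [add_mul, Finset.sum_add_distrib]
        map_smul' := fun r c => by
          funext m; simp [Finset.mul_sum, mul_assoc] }
    have hinj : Function.Injective Φ := by
      rw [← LinearMap.ker_eq_bot, LinearMap.ker_eq_bot']
      intro c hc
      have hL : ∑ x : t, c x • ev x.1 = 0 := by
        refine f.functional_eq_zero hd hdk hk _ y (fun g i => ?_) fun m hm => ?_
        · simp only [LinearMap.sum_apply, LinearMap.smul_apply, hev, smul_eq_mul, map_mul,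
            Finset.mul_sum]
          refine Finset.sum_congr rfl fun x _ => ?_
          have : f.lift x.1 i = y i := congrFun (ht x.2) i
          rw [HolMap.lift] at this
          rw [this]; ring
        · have := congrFun hc ⟨m, by simpa using hm⟩
          simpa [LinearMap.sum_apply, hev, Φ] using this
      have hli : LinearIndependent ℂ
          (fun φ : MvPolynomial (Fin 3) ℂ →* ℂ => (φ : MvPolynomial (Fin 3) ℂ → ℂ)) :=
        linearIndependent_monoidHom _ _
      have hinj' : Function.Injective
          (fun x : t => ((eval x.1 : MvPolynomial (Fin 3) ℂ →+* ℂ) :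
            MvPolynomial (Fin 3) ℂ →* ℂ)) := by
        intro x x' h
        apply Subtype.ext
        funext i
        simpa using DFunLike.congr_fun h (X i)
      have hli' := Fintype.linearIndependent_iff.1 (hli.comp _ hinj') c (by
        funext p
        have := LinearMap.congr_fun hL p
        simpa [LinearMap.sum_apply, hev] using this)
      funext x
      exact hli' x
    have := LinearMap.finrank_le_finrank_of_injective hinj
    simpa using this
  by_contra! hlt
  obtain ⟨s, hs, hcard⟩ := Set.exists_subset_encard_eq (Order.add_one_le_of_lt hlt)
  have hsfin : s.Finite := Set.finite_of_encard_eq_coe (k := hfin.toFinset.card + 1) (by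
    rw [hcard]; norm_cast)
  have h1 := key hsfin.toFinset (by simpa using hs)
  rw [hsfin.encard_eq_coe_toFinset_card] at hcard
  have : hsfin.toFinset.card = hfin.toFinset.card + 1 := by exact_mod_cast hcard
  omega

open MvPolynomial in
/-- The ideal of the origin has height three: it is the top of the chain of the ideals
`(X₀, …, X_{j-1})`, `j ≤ 3`. -/
theorem three_le_height_vanishingIdeal_zero :
    3 ≤ (vanishingIdeal ℂ {(0 : Fin 3 → ℂ)}).height := by
  -- The kernel of the substitution `X_i = 0` for `i < j` is prime, its target being a domain.
  let φ : ℕ → MvPolynomial (Fin 3) ℂ →ₐ[ℂ] MvPolynomial (Fin 3) ℂ :=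
    fun j => aeval fun i => if i.1 < j then 0 else X i
  have hprime : ∀ j, (RingHom.ker (φ j)).IsPrime := fun j => RingHom.ker_isPrime _
  have hcomp : ∀ j, (φ (j + 1)).comp (φ j) = φ (j + 1) := by
    intro j
    apply algHom_ext
    intro i
    by_cases hi : i.1 < j
    · simp [φ, hi, Nat.lt_succ_of_lt hi, -Order.lt_add_one_iff]
    · simp [φ, hi]
  have hlt : ∀ j (hj : j < 3), RingHom.ker (φ j) < RingHom.ker (φ (j + 1)) := by
    intro j hj
    refine SetLike.lt_iff_le_and_exists.2 ⟨fun p hp => ?_, X ⟨j, hj⟩, ?_, ?_⟩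
    · rw [RingHom.mem_ker] at hp ⊢
      rw [← hcomp j, AlgHom.comp_apply, hp, map_zero]
    · simp [RingHom.mem_ker, φ]
    · simp [RingHom.mem_ker, φ]
  have hstep : ∀ j (hj : j < 3),
      (RingHom.ker (φ j)).height + 1 ≤ (RingHom.ker (φ (j + 1))).height := fun j hj =>
    haveI := hprime j
    haveI := hprime (j + 1)
    Ideal.height_add_one_le_of_lt_of_isPrime (hlt j hj)
  have h3 : (RingHom.ker (φ 3)) ≤ vanishingIdeal ℂ {(0 : Fin 3 → ℂ)} := by
    intro p hp x hx
    rw [Set.mem_singleton_iff.1 hx]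
    have h : (aeval (0 : Fin 3 → ℂ)).comp (φ 3) = aeval (0 : Fin 3 → ℂ) := by
      apply algHom_ext
      intro i
      simp [φ]
    rw [← h, AlgHom.comp_apply, (RingHom.mem_ker).1 hp, map_zero]
  refine le_trans ?_ (Ideal.height_mono h3)
  have h01 := hstep 0 (by norm_num)
  have h12 := hstep 1 (by norm_num)
  have h23 := hstep 2 (by norm_num)
  have h1 : (1 : ℕ∞) ≤ (RingHom.ker (φ 1)).height := le_add_self.trans h01
  have h2 : (1 + 1 : ℕ∞) ≤ (RingHom.ker (φ 2)).height := (add_le_add_left h1 1).trans h12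
  calc (3 : ℕ∞) = 1 + 1 + 1 := by norm_num
    _ ≤ _ := (add_le_add_left h2 1).trans h23

open MvPolynomial in
/-- Two homogeneous equations in three unknowns have a nontrivial solution, by Krull's height
theorem. -/
theorem exists_common_zero (Q : Fin 2 → MvPolynomial (Fin 3) ℂ) (h0 : ∀ j, eval 0 (Q j) = 0) :
    ∃ v : Fin 3 → ℂ, v ≠ 0 ∧ ∀ j, eval v (Q j) = 0 := by
  by_contra! h
  set I := Ideal.span (Set.range Q) with hI
  have hz : zeroLocus ℂ I = {(0 : Fin 3 → ℂ)} := by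
    rw [hI, zeroLocus_span]
    ext x
    simp only [Set.mem_ofPred_eq, Set.forall_mem_range, aeval_eq_eval, Set.mem_singleton_iff]
    refine ⟨fun hx => ?_, fun hx j => by simpa [hx] using h0 j⟩
    by_contra hx0
    obtain ⟨j, hj⟩ := h x hx0
    exact hj (by simpa using hx j)
  have hrad : I.radical = vanishingIdeal ℂ {(0 : Fin 3 → ℂ)} := by
    rw [← hz, vanishingIdeal_zeroLocus_eq_radical]
  have hmin : vanishingIdeal ℂ {(0 : Fin 3 → ℂ)} ∈ I.minimalPrimes := by
    refine ⟨⟨inferInstance, hrad ▸ Ideal.le_radical⟩, fun q hq _ => ?_⟩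
    rw [← hrad]
    exact hq.1.radical_le_iff.2 hq.2
  have h1 := Ideal.height_le_card_of_mem_minimalPrimes_span (Set.finite_range Q) hmin
  have h2 : (Set.range Q).ncard ≤ 2 := by
    rw [← Nat.card_coe_set_eq]
    simpa using Finite.card_range_le Q
  have h3 : (3 : ℕ∞) ≤ 2 :=
    (three_le_height_vanishingIdeal_zero.trans h1).trans (by exact_mod_cast h2)
  exact absurd h3 (by norm_num)

open MvPolynomial in
theorem HolMap.lift_surjective (f : HolMap d) (hd : d ≠ 0) : Function.Surjective f.lift := by
  intro a
  by_cases ha : a = 0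
  · exact ⟨0, by rw [ha, f.lift_zero hd]⟩
  obtain ⟨i, hi⟩ := Function.ne_iff.1 ha
  rw [Pi.zero_apply] at hi
  have h00 : ∀ i, eval 0 (f.poly i) = 0 := fun i => congrFun (f.lift_zero hd) i
  -- `F v` is proportional to `a`, for which two equations suffice as `a i ≠ 0`.
  obtain ⟨v, hv, hv0⟩ := exists_common_zero
    (fun j => C (a i) * f.poly (i.succAbove j) - C (a (i.succAbove j)) * f.poly i)
    (fun j => by rw [map_sub, map_mul, map_mul, h00, h00, mul_zero, mul_zero, sub_zero])
  have hprop : ∀ j, a i * f.lift v j = a j * f.lift v i := by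
    intro j
    by_cases hj : j = i
    · rw [hj]
    · obtain ⟨j', rfl⟩ := Fin.exists_succAbove_eq hj
      have := hv0 j'
      simp only [map_sub, map_mul, eval_C] at this
      exact sub_eq_zero.1 this
  have hfi : f.lift v i ≠ 0 := fun h => by
    refine hv (f.no_common_zero v fun j => ?_)
    have := hprop j
    rw [h, mul_zero] at this
    exact (mul_eq_zero.1 this).resolve_left hi
  obtain ⟨c, hc⟩ := IsAlgClosed.exists_pow_nat_eq (a i / f.lift v i) (Nat.pos_of_ne_zero hd)
  refine ⟨c • v, ?_⟩
  rw [f.lift_smul, hc]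
  funext j
  rw [Pi.smul_apply, smul_eq_mul, div_mul_eq_mul_div, div_eq_iff hfi, hprop j]

/-! ### Jensen's inequality and the size of the sublevel sets of an entire function -/

open Real in
/-- Jensen's inequality for a truncated logarithm; the truncation makes the integrand
continuous. -/
theorem log_norm_le_circleAverage_log_max {g : ℂ → ℂ} (hg : Differentiable ℂ g) (h0 : g 0 ≠ 0)
    {ε : ℝ} (hε : 0 < ε) :
    log ‖g 0‖ ≤ circleAverage (fun z => log (max ‖g z‖ ε)) 0 1 := by
  have han : AnalyticOnNhd ℂ g Set.univ := fun z _ => hg.analyticAt z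
  have hball : AnalyticOnNhd ℂ g (Metric.closedBall 0 |1|) := han.mono (Set.subset_univ _)
  have hJ := hball.circleAverage_log_norm one_ne_zero h0
  have hsum : 0 ≤ ∑ᶠ u, (MeromorphicOn.divisor g (Metric.closedBall 0 |1|) u : ℝ) *
      log (1 * ‖0 - u‖⁻¹) := by
    refine finsum_nonneg fun u => ?_
    by_cases hu : u ∈ Metric.closedBall (0 : ℂ) |1|
    · refine mul_nonneg (mod_cast MeromorphicOn.AnalyticOnNhd.divisor_nonneg hball u) ?_
      have hu1 : ‖u‖ ≤ 1 := by simpa using hu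
      by_cases hu0 : u = 0
      · simp [hu0]
      · refine log_nonneg ?_
        rw [one_mul, zero_sub, norm_neg]
        exact (one_le_inv₀ (norm_pos_iff.2 hu0)).2 hu1
    · rw [Function.locallyFinsuppWithin.apply_eq_zero_of_notMem _ hu, Int.cast_zero, zero_mul]
  -- The logarithm vanishes at `0`, so the comparison holds only away from the zeros of `g`.
  let h : ℂ → ℝ := fun z => if g z = 0 then log ε else log ‖g z‖
  have hcod : (fun z => log ‖g z‖) =ᶠ[codiscreteWithin (Metric.sphere (0 : ℂ) |1|)] h := by
    have := codiscreteWithin_mono (Set.subset_univ (Metric.sphere (0 : ℂ) |1|))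
      (han.preimage_zero_mem_codiscrete h0)
    filter_upwards [this] with z hz
    have : g z ≠ 0 := hz
    simp [h, this]
  have hint : CircleIntegrable (fun z => log ‖g z‖) 0 1 :=
    (han.mono (Set.subset_univ _)).meromorphicOn.circleIntegrable_log_norm
  have hcont : Continuous fun z => log (max ‖g z‖ ε) :=
    (hg.continuous.norm.max continuous_const).log fun z => (lt_max_of_lt_right hε).ne'
  calc log ‖g 0‖ ≤ circleAverage (fun z => log ‖g z‖) 0 1 := by rw [hJ]; linarith
    _ = circleAverage h 0 1 := circleAverage_congr_codiscreteWithin hcod one_ne_zero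
    _ ≤ _ := by
      refine circleAverage_mono (hint.congr_codiscreteWithin hcod)
        hcont.continuousOn.circleIntegrable' fun z _ => ?_
      by_cases hz : g z = 0
      · simp only [h, hz, if_true]
        exact log_le_log hε (le_max_right _ _)
      · simp only [h, hz, if_false]
        exact log_le_log (norm_pos_iff.2 hz) (le_max_left _ _)

open MeasureTheory

theorem measurePreserving_circle_smul {ι : Type*} [Fintype ι] {u : ℂ} (hu : ‖u‖ = 1) :
    MeasurePreserving (fun v : ι → ℂ => u • v) := by
  refine volume_preserving_pi (f := fun _ z => u * z) fun _ => ?_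
  exact (rotation ⟨u, by simpa [Submonoid.unitSphere] using hu⟩).measurePreserving

/-- The mean value inequality over balls follows from the one over circles in complex lines,
because balls are invariant under rotations `v ↦ e^{iθ} v`. -/
theorem mul_volume_closedBall_le_integral {ι : Type*} [Fintype ι] {H : (ι → ℂ) → ℝ}
    (hH : Continuous H) {c : ℝ} (x₀ : ι → ℂ) (r : ℝ)
    (hc : ∀ v, c ≤ Real.circleAverage (fun z => H (x₀ + z • v)) 0 1) :
    c * volume.real (Metric.closedBall x₀ r) ≤ ∫ x in Metric.closedBall x₀ r, H x := by
  set B : Set (ι → ℂ) := Metric.closedBall 0 r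
  have htrans : ∫ x in Metric.closedBall x₀ r, H x = ∫ v in B, H (x₀ + v) := by
    rw [← (measurePreserving_add_left volume x₀).setIntegral_preimage_emb
      (measurableEmbedding_addLeft x₀)]
    congr 2
    ext v
    simp [B]
  have hrot : ∀ θ : ℝ, ∫ v in B, H (x₀ + circleMap 0 1 θ • v) = ∫ v in B, H (x₀ + v) := by
    intro θ
    have hu : ‖circleMap 0 1 θ‖ = 1 := by simp
    have hu0 : circleMap 0 1 θ ≠ 0 := fun h => by simp [h] at hu
    rw [← (measurePreserving_circle_smul (ι := ι) hu).setIntegral_preimage_emb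
      (Homeomorph.smulOfNeZero _ hu0).measurableEmbedding (fun v => H (x₀ + v))]
    congr 2
    ext v
    simp [B, norm_smul]
  have hB : IsCompact B := isCompact_closedBall _ _
  have hcont : Continuous fun p : ℝ × (ι → ℂ) => H (x₀ + circleMap 0 1 p.1 • p.2) := by
    fun_prop
  have hswap := intervalIntegral_integral_swap (μ := volume.restrict B) (a := 0)
    (b := 2 * Real.pi) (f := fun θ v => H (x₀ + circleMap 0 1 θ • v)) (by
      rw [Measure.prod_restrict, ← IntegrableOn]
      refine IntegrableOn.mono_set ?_
        (Set.prod_mono_left Set.uIoc_subset_uIcc)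
      exact hcont.continuousOn.integrableOn_compact (isCompact_uIcc.prod hB))
  simp only [hrot, intervalIntegral.integral_const, sub_zero, smul_eq_mul] at hswap
  have hpi : (0 : ℝ) < 2 * Real.pi := Real.two_pi_pos
  have hlow : ∫ v in B, 2 * Real.pi * c ≤
      ∫ v in B, ∫ θ in (0 : ℝ)..2 * Real.pi, H (x₀ + circleMap 0 1 θ • v) := by
    refine setIntegral_mono_on (integrableOn_const hB.measure_lt_top.ne) ?_
      measurableSet_closedBall fun v _ => ?_
    · refine ContinuousOn.integrableOn_compact hB (Continuous.continuousOn ?_)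
      exact intervalIntegral.continuous_parametric_intervalIntegral_of_continuous'
        (f := fun v θ => H (x₀ + circleMap 0 1 θ • v)) (by fun_prop) _ _
    · have := hc v
      rw [Real.circleAverage_def, smul_eq_mul, ← div_eq_inv_mul, le_div_iff₀ hpi] at this
      linarith
  rw [← hswap, setIntegral_const, smul_eq_mul] at hlow
  have hvol : volume.real (Metric.closedBall x₀ r) = volume.real B := by
    simp only [B, Measure.real, Measure.addHaar_closedBall_center]
  rw [htrans, hvol]
  nlinarith

/-- The logarithm of an entire function that is not small at one point has a controlled integral
over a ball: the mean value inequality at that point is used on a larger ball. -/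
theorem integral_sub_log_max_le {ι : Type*} [Fintype ι] {G : (ι → ℂ) → ℂ}
    (hG : Differentiable ℂ G) {x₀ : ι → ℂ} (h0 : G x₀ ≠ 0) {K : Set (ι → ℂ)} {r M ε : ℝ}
    (hK : K ⊆ Metric.closedBall x₀ r) (hε : 0 < ε) (hεM : ε ≤ Real.exp M)
    (hM : ∀ x ∈ Metric.closedBall x₀ r, ‖G x‖ ≤ Real.exp M) :
    ∫ x in K, (M - Real.log (max ‖G x‖ ε)) ≤
      volume.real (Metric.closedBall x₀ r) * (M - Real.log ‖G x₀‖) := by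
  have hcont : Continuous fun x => Real.log (max ‖G x‖ ε) :=
    (hG.continuous.norm.max continuous_const).log fun z => (lt_max_of_lt_right hε).ne'
  have hint : IntegrableOn (fun x => Real.log (max ‖G x‖ ε)) (Metric.closedBall x₀ r) :=
    hcont.continuousOn.integrableOn_compact (isCompact_closedBall _ _)
  have hintc : IntegrableOn (fun _ : ι → ℂ => M) (Metric.closedBall x₀ r) :=
    integrableOn_const (isCompact_closedBall _ _).measure_lt_top.ne
  have hmean := mul_volume_closedBall_le_integral hcont (c := Real.log ‖G x₀‖) x₀ r (fun v => by
    have hg : Differentiable ℂ fun z : ℂ => G (x₀ + z • v) := by fun_prop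
    simpa using log_norm_le_circleAverage_log_max hg (by simpa using h0) hε)
  have hnonneg : ∀ x ∈ Metric.closedBall x₀ r, 0 ≤ M - Real.log (max ‖G x‖ ε) := fun x hx => by
    rw [sub_nonneg, Real.log_le_iff_le_exp (lt_max_of_lt_right hε)]
    exact max_le (hM x hx) hεM
  calc ∫ x in K, (M - Real.log (max ‖G x‖ ε))
      ≤ ∫ x in Metric.closedBall x₀ r, (M - Real.log (max ‖G x‖ ε)) := by
        refine setIntegral_mono_set (hintc.sub hint) ?_ hK.eventuallyLE
        exact (ae_restrict_mem measurableSet_closedBall).mono hnonneg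
    _ = volume.real (Metric.closedBall x₀ r) * M -
          ∫ x in Metric.closedBall x₀ r, Real.log (max ‖G x‖ ε) := by
        rw [integral_sub hintc hint, setIntegral_const, smul_eq_mul]
    _ ≤ _ := by linarith

/-! ### Change of variables for maps with bounded fibres -/

/-- A differentiable map whose fibres have at most `N` points multiplies the volume at least by the
mean of its Jacobian divided by `N`: away from the critical set, the domain splits into countably
many pieces on which the map is injective. -/
theorem lintegral_abs_det_fderiv_le_mul_measure_image {E : Type*} [NormedAddCommGroup E]
    [NormedSpace ℝ E] [FiniteDimensional ℝ E] [Nontrivial E] [MeasurableSpace E] [BorelSpace E]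
    (μ : Measure E) [μ.IsAddHaarMeasure] {g : E → E} {g' : E → E →L[ℝ] E}
    (hg : ∀ x, HasFDerivAt g (g' x) x) (hg' : Measurable fun x => (g' x).det) {N : ℕ}
    (hN : ∀ y, (g ⁻¹' {y}).encard ≤ N) {A : Set E} (hA : MeasurableSet A) :
    ∫⁻ x in A, ENNReal.ofReal |(g' x).det| ∂μ ≤ N * μ (g '' A) := by
  classical
  set U : Set E := A ∩ {x | (g' x).det ≠ 0} with hU
  have hUm : MeasurableSet U :=
    hA.inter (hg' (measurableSet_singleton (0 : ℝ)).compl)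
  -- A map this close to an invertible linear map `B` is injective.
  let r : (E →L[ℝ] E) → NNReal := fun B =>
    if h : B.det ≠ 0 then ‖((B.toContinuousLinearEquivOfDetNeZero h).symm : E →L[ℝ] E)‖₊⁻¹ / 2
    else 1
  have hrpos : ∀ B : E →L[ℝ] E, ∀ h : B.det ≠ 0,
      0 < ‖((B.toContinuousLinearEquivOfDetNeZero h).symm : E →L[ℝ] E)‖₊⁻¹ := fun B h =>
    inv_pos.2 (ContinuousLinearEquiv.nnnorm_symm_pos _)
  have hr0 : ∀ B, r B ≠ 0 := by
    intro B
    by_cases h : B.det ≠ 0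
    · simp only [r, dif_pos h]
      exact (half_pos (hrpos B h)).ne'
    · simp only [r, dif_neg h]
      exact one_ne_zero
  obtain ⟨t, B, htd, htm, hUt, happ, hB⟩ :=
    exists_partition_approximatesLinearOn_of_hasFDerivWithinAt g U g'
      (fun x _ => (hg x).hasFDerivWithinAt) r hr0
  have hinj : ∀ n, Set.InjOn g (U ∩ t n) := by
    intro n
    rcases U.eq_empty_or_nonempty with hne | hne
    · simp [hne]
    obtain ⟨y, hy, hBy⟩ := hB hne n
    have hdet : (B n).det ≠ 0 := by rw [hBy]; exact hy.2
    have h := happ n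
    rw [← (B n).coe_toContinuousLinearEquivOfDetNeZero hdet] at h
    refine ApproximatesLinearOn.injOn h (Or.inr ?_)
    simp only [ContinuousLinearMap.coe_toContinuousLinearEquivOfDetNeZero, r, dif_pos hdet]
    exact half_lt_self (hrpos _ hdet)
  have hpm : ∀ n, MeasurableSet (U ∩ t n) := fun n => hUm.inter (htm n)
  have him : ∀ n, MeasurableSet (g '' (U ∩ t n)) := fun n =>
    measurable_image_of_fderivWithin (hpm n) (fun x _ => (hg x).hasFDerivWithinAt) (hinj n)
  have hUeq : U = ⋃ n, U ∩ t n := by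
    rw [← Set.inter_iUnion]; exact (Set.inter_eq_left.2 hUt).symm
  have hcount : ∀ y, ∑' n, (g '' (U ∩ t n)).indicator (fun _ => (1 : ENNReal)) y ≤
      (⋃ n, g '' (U ∩ t n)).indicator (fun _ => (N : ENNReal)) y := by
    intro y
    by_cases hy : y ∈ ⋃ n, g '' (U ∩ t n)
    · rw [Set.indicator_of_mem hy, ENNReal.tsum_eq_iSup_sum]
      refine iSup_le fun s => ?_
      rw [Finset.sum_indicator_eq_sum_filter (f := fun _ _ => (1 : ENNReal))
        (t := fun n => g '' (U ∩ t n)) (g := fun _ => y), Finset.sum_const, nsmul_eq_mul, mul_one]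
      set s' := s.filter fun n => y ∈ g '' (U ∩ t n)
      have hx : ∀ n : s', ∃ x ∈ U ∩ t n, g x = y := fun n => (Finset.mem_filter.1 n.2).2
      choose x hx hgx using hx
      have hxinj : Function.Injective x := by
        intro m n hmn
        by_contra hne
        have hne' : (m : ℕ) ≠ n := fun h => hne (Subtype.ext h)
        exact Set.disjoint_left.1 (htd hne') (hx m).2 (hmn ▸ (hx n).2)
      have hcard : (s'.card : ℕ∞) ≤ N := by
        calc (s'.card : ℕ∞) = (Set.univ : Set s').encard := by simp
          _ = (x '' Set.univ).encard := (hxinj.injOn.encard_image).symm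
          _ ≤ (g ⁻¹' {y}).encard := Set.encard_le_encard (by
              rintro _ ⟨n, -, rfl⟩
              exact hgx n)
          _ ≤ N := hN y
      exact_mod_cast hcard
    · rw [Set.indicator_of_notMem hy]
      refine (ENNReal.tsum_eq_zero.2 fun n => Set.indicator_of_notMem (fun h => hy ?_) _).le
      exact Set.mem_iUnion.2 ⟨n, h⟩
  calc ∫⁻ x in A, ENNReal.ofReal |(g' x).det| ∂μ
      = ∫⁻ x in U, ENNReal.ofReal |(g' x).det| ∂μ := by
        rw [← lintegral_indicator hA, ← lintegral_indicator hUm]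
        congr 1
        funext x
        by_cases hx : x ∈ A
        · by_cases hd : (g' x).det = 0 <;> simp [hU, hx, hd]
        · simp [hU, hx]
    _ = ∑' n, ∫⁻ x in U ∩ t n, ENNReal.ofReal |(g' x).det| ∂μ := by
        conv_lhs => rw [hUeq]
        exact lintegral_iUnion hpm (fun m n h => (htd h).mono Set.inter_subset_right
          Set.inter_subset_right) _
    _ = ∑' n, μ (g '' (U ∩ t n)) := by
        congr 1
        funext n
        exact lintegral_abs_det_fderiv_eq_addHaar_image μ (hpm n)
          (fun x _ => (hg x).hasFDerivWithinAt) (hinj n)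
    _ = ∫⁻ y, ∑' n, (g '' (U ∩ t n)).indicator (fun _ => (1 : ENNReal)) y ∂μ := by
        rw [lintegral_tsum fun n => (measurable_const.indicator (him n)).aemeasurable]
        congr 1
        funext n
        rw [lintegral_indicator (him n), setLIntegral_one]
    _ ≤ ∫⁻ y, (⋃ n, g '' (U ∩ t n)).indicator (fun _ => (N : ENNReal)) y ∂μ :=
        lintegral_mono hcount
    _ = N * μ (⋃ n, g '' (U ∩ t n)) := by
        rw [lintegral_indicator (MeasurableSet.iUnion him), setLIntegral_const]
    _ ≤ N * μ (g '' A) := by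
        gcongr
        exact Set.iUnion_subset fun n => Set.image_mono fun x hx => hx.1.1

theorem encard_preimage_iterate_le {α : Type*} {g : α → α} {N : ℕ}
    (hN : ∀ y, (g ⁻¹' {y}).encard ≤ N) (n : ℕ) (y : α) :
    (g^[n] ⁻¹' {y}).encard ≤ (N ^ n : ℕ) := by
  classical
  induction n generalizing y with
  | zero => simp
  | succ n ih =>
    have hfin : (g ⁻¹' {y}).Finite := Set.finite_of_encard_le_coe (hN y)
    have heq : g^[n + 1] ⁻¹' {y} = ⋃ z ∈ hfin.toFinset, g^[n] ⁻¹' {z} := by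
      ext x
      simp [← Function.iterate_succ_apply, Function.iterate_succ_apply']
    rw [heq]
    calc (⋃ z ∈ hfin.toFinset, g^[n] ⁻¹' {z}).encard
        ≤ ∑ z ∈ hfin.toFinset, (g^[n] ⁻¹' {z}).encard := by
          induction hfin.toFinset using Finset.induction_on with
          | empty => simp
          | insert a s ha hs =>
            rw [Finset.set_biUnion_insert, Finset.sum_insert ha]
            exact (Set.encard_union_le _ _).trans (by gcongr)
      _ ≤ ∑ z ∈ hfin.toFinset, ((N ^ n : ℕ) : ℕ∞) := Finset.sum_le_sum fun z _ => ih z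
      _ = hfin.toFinset.card * ((N ^ n : ℕ) : ℕ∞) := by simp
      _ ≤ N * ((N ^ n : ℕ) : ℕ∞) := by
          have := hN y
          rw [hfin.encard_eq_coe_toFinset_card] at this
          exact mul_le_mul_left this _
      _ = _ := by push_cast; ring

/-! ### The Fubini-Study volume and the Lebesgue measure of cones -/

/-- The nonzero vectors representing the points of `T`. -/
def cone (T : Set P2) : Set (Fin 3 → ℂ) :=
  {v | ∃ h : v ≠ 0, Projectivization.mk ℂ v h ∈ T}

theorem cone_mono {S T : Set P2} (h : S ⊆ T) : cone S ⊆ cone T :=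
  fun _ ⟨hv, hvS⟩ => ⟨hv, h hvS⟩

theorem measurableSet_cone {T : Set P2} (hT : MeasurableSet T) : MeasurableSet (cone T) := by
  have hc : Continuous
      (fun v : {v : Fin 3 → ℂ // v ≠ 0} => (Projectivization.mk' ℂ v : P2)) :=
    continuous_coinduced_rng
  have h1 : MeasurableSet ((fun v : {v : Fin 3 → ℂ // v ≠ 0} =>
      (Projectivization.mk' ℂ v : P2)) ⁻¹' T) := hc.measurable hT
  have h2 : MeasurableSet {v : Fin 3 → ℂ | v ≠ 0} := (measurableSet_singleton 0).compl
  have h3 : cone T = Subtype.val '' ((fun v : {v : Fin 3 → ℂ // v ≠ 0} =>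
      (Projectivization.mk' ℂ v : P2)) ⁻¹' T) := by
    ext v
    constructor
    · rintro ⟨h, hv⟩
      exact ⟨⟨v, h⟩, hv, rfl⟩
    · rintro ⟨w, hw, rfl⟩
      exact ⟨w.2, hw⟩
  rw [h3]
  exact h2.subtype_image h1

theorem smul_insertNth_mem_cone {T : Set P2} {t : ℂ} (ht : t ≠ 0) (i : Fin 3) (ζ : Fin 2 → ℂ) :
    t • (i.insertNth (1 : ℂ) ζ : Fin 3 → ℂ) ∈ cone T ↔ affinePoint i ζ ∈ T := by
  have hne : t • (i.insertNth (1 : ℂ) ζ : Fin 3 → ℂ) ≠ 0 :=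
    smul_ne_zero ht (insertNth_one_ne_zero i ζ)
  have heq : Projectivization.mk ℂ _ hne = affinePoint i ζ := by
    rw [affinePoint, Projectivization.mk_eq_mk_iff']
    exact ⟨t, rfl⟩
  rw [← heq]
  exact ⟨fun ⟨_, h⟩ => h, fun h => ⟨hne, h⟩⟩

/-- Multiplication by `t` in dimension two multiplies the volume by `‖t‖ ^ 4`. -/
theorem volume_preimage_inv_smul {t : ℂ} (ht : t ≠ 0) {S : Set (Fin 2 → ℂ)}
    (hS : MeasurableSet S) :
    volume ((fun w : Fin 2 → ℂ => t⁻¹ • w) ⁻¹' S) = ENNReal.ofReal (‖t‖ ^ 4) * volume S := by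
  have hn : ‖t‖ ≠ 0 := norm_ne_zero_iff.2 ht
  set u : ℂ := ‖t‖ * t⁻¹
  have hu : ‖u‖ = 1 := by simp [u, hn]
  have heq : (fun w : Fin 2 → ℂ => t⁻¹ • w) =
      (fun w => u • w) ∘ fun w : Fin 2 → ℂ => ‖t‖⁻¹ • w := by
    funext w i
    have hn' : (‖t‖ : ℂ) ≠ 0 := Complex.ofReal_ne_zero.2 hn
    simp [u]
    field_simp
  have hmp := measurePreserving_circle_smul (ι := Fin 2) hu
  rw [heq, Set.preimage_comp, Measure.addHaar_preimage_smul _ (inv_ne_zero hn),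
    hmp.measure_preimage hS.nullMeasurableSet]
  congr 2
  have : Module.finrank ℝ (Fin 2 → ℂ) = 4 := by
    rw [Module.finrank_pi_fintype]; simp
  rw [this, inv_pow, inv_inv, abs_of_nonneg (by positivity)]

/-- Fubini's theorem in the coordinates `(t, ζ) ↦ t • (ζ₀, ζ₁, 1)`. -/
theorem volume_eq_lintegral_slices {S : Set (Fin 3 → ℂ)} (hS : MeasurableSet S) :
    volume S = ∫⁻ t : ℂ, ENNReal.ofReal (‖t‖ ^ 4) *
      volume {ζ : Fin 2 → ℂ | t • ((Fin.last 2).insertNth (1 : ℂ) ζ : Fin 3 → ℂ) ∈ S} := by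
  have hmp := (volume_preserving_piFinSuccAbove (fun _ : Fin 3 => ℂ) (Fin.last 2)).symm
  rw [← hmp.measure_preimage hS.nullMeasurableSet]
  rw [Measure.volume_eq_prod, Measure.prod_apply (hmp.measurable hS)]
  refine lintegral_congr_ae ?_
  have hae : ∀ᵐ t : ℂ, t ≠ 0 := by simp [ae_iff]
  filter_upwards [hae] with t ht
  have hmeas : Measurable fun ζ : Fin 2 → ℂ =>
      t • ((Fin.last 2).insertNth (1 : ℂ) ζ : Fin 3 → ℂ) := by
    refine Continuous.measurable ?_
    fun_prop
  refine Eq.trans ?_ (volume_preimage_inv_smul ht (hmeas hS))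
  congr 1
  ext w
  have : t • ((Fin.last 2).insertNth (1 : ℂ) (t⁻¹ • w) : Fin 3 → ℂ) =
      (Fin.last 2).insertNth t w := by
    funext j
    refine (Fin.last 2).succAboveCases ?_ (fun j => ?_) j
    · simp
    · simp [ht]
  simp only [Set.mem_preimage, Set.mem_ofPred_eq, this]
  rfl

theorem fsVolume_apply {T : Set P2} (hT : MeasurableSet T) :
    fsVolume T = ∫⁻ ζ in affinePoint (Fin.last 2) ⁻¹' T,
      ENNReal.ofReal (2 / (Real.pi ^ 2 * (1 + ∑ j, ‖ζ j‖ ^ 2) ^ 3)) := by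
  have hm : Measurable (affinePoint (Fin.last 2)) := (continuous_affinePoint _).measurable
  rw [fsVolume, Measure.map_apply hm hT, withDensity_apply _ (hm hT)]

theorem volume_cone_pos {T : Set P2} (hT : MeasurableSet T) (h : 0 < fsVolume T) :
    0 < volume (cone T) := by
  have hm : Measurable (affinePoint (Fin.last 2)) := (continuous_affinePoint _).measurable
  rw [pos_iff_ne_zero] at h ⊢
  intro h0
  apply h
  rw [fsVolume_apply hT]
  have hzero : volume (affinePoint (Fin.last 2) ⁻¹' T) = 0 := by
    rw [volume_eq_lintegral_slices (measurableSet_cone hT), lintegral_eq_zero_iff'] at h0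
    · have hae : ∀ᵐ t : ℂ, t ≠ 0 := by simp [ae_iff]
      obtain ⟨t, ht0, ht⟩ := (h0.and hae).exists
      simp only [smul_insertNth_mem_cone ht, Pi.zero_apply, mul_eq_zero,
        ENNReal.ofReal_eq_zero] at ht0
      refine ht0.resolve_left ?_
      have := norm_pos_iff.2 ht
      exact not_le.2 (by positivity)
    · refine AEMeasurable.mul (by fun_prop) ?_
      have hmeas : Measurable fun p : ℂ × (Fin 2 → ℂ) =>
          p.1 • ((Fin.last 2).insertNth (1 : ℂ) p.2 : Fin 3 → ℂ) := by
        refine Continuous.measurable ?_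
        fun_prop
      exact (measurable_measure_prodMk_left (hmeas (measurableSet_cone hT))).aemeasurable
  rw [Measure.restrict_eq_zero.2 hzero, lintegral_zero_measure]

/-- The part of a cone in a ball of radius `R` has Lebesgue measure at most a constant times
`R ^ 6` times the Fubini-Study volume of its base. -/
theorem volume_cone_inter_closedBall_le (T : Set P2) {R : ℝ} (hR : 0 ≤ R) :
    volume (cone T ∩ Metric.closedBall 0 R) ≤
      ENNReal.ofReal (27 * Real.pi ^ 3 / 2 * R ^ 6) * fsVolume T := by
  wlog hT : MeasurableSet T generalizing T
  · rw [← measure_toMeasurable T]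
    refine le_trans (measure_mono ?_)
      (this (toMeasurable fsVolume T) (measurableSet_toMeasurable _ _))
    exact Set.inter_subset_inter_left _ (cone_mono (subset_toMeasurable _ _))
  have hm : Measurable (affinePoint (Fin.last 2)) := (continuous_affinePoint _).measurable
  set ι : (Fin 2 → ℂ) → Fin 3 → ℂ := fun ζ => (Fin.last 2).insertNth (1 : ℂ) ζ with hι
  have hιc : Continuous ι := by simp only [hι]; fun_prop
  have hpos : ∀ ζ, 0 < ‖ι ζ‖ := fun ζ => norm_pos_iff.2 (insertNth_one_ne_zero _ _)
  set T' := affinePoint (Fin.last 2) ⁻¹' T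
  have hT' : MeasurableSet T' := hm hT
  -- In the coordinates `(t, ζ)` the ball of radius `R` is `‖t‖ * ‖ι ζ‖ ≤ R`; for fixed `ζ` it is a
  -- disc, whose contribution is compared with the Fubini-Study density.
  let D : Set (ℂ × (Fin 2 → ℂ)) := {p | ‖p.1‖ * ‖ι p.2‖ ≤ R}
  have hD : MeasurableSet D := by
    refine (isClosed_le ?_ continuous_const).measurableSet
    fun_prop
  let k : ℂ → (Fin 2 → ℂ) → ENNReal := fun t ζ =>
    D.indicator (fun p => ENNReal.ofReal (‖p.1‖ ^ 4)) (t, ζ)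
  have hk : Measurable (Function.uncurry k) := by
    refine Measurable.indicator ?_ hD
    fun_prop
  have hae : ∀ᵐ t : ℂ, t ≠ 0 := by simp [ae_iff]
  have hslice : ∀ t : ℂ, t ≠ 0 → ENNReal.ofReal (‖t‖ ^ 4) *
      volume {ζ : Fin 2 → ℂ | t • ι ζ ∈ cone T ∩ Metric.closedBall 0 R} =
      ∫⁻ ζ in T', k t ζ := by
    intro t ht
    have hDt : MeasurableSet {ζ | (t, ζ) ∈ D} := measurable_prodMk_left hD
    have : {ζ : Fin 2 → ℂ | t • ι ζ ∈ cone T ∩ Metric.closedBall 0 R} =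
        {ζ | (t, ζ) ∈ D} ∩ T' := by
      ext ζ
      simp only [Set.mem_ofPred_eq, Set.mem_inter_iff, hι, smul_insertNth_mem_cone ht, D,
        Metric.mem_closedBall, dist_zero_right, norm_smul, T', Set.mem_preimage]
      exact and_comm
    have hkt : k t = {ζ | (t, ζ) ∈ D}.indicator fun _ => ENNReal.ofReal (‖t‖ ^ 4) := by
      funext ζ
      simp [k, Set.indicator]
    rw [this, hkt, lintegral_indicator hDt, setLIntegral_const, Measure.restrict_apply hDt]
  have hinner : ∀ ζ, ∫⁻ t : ℂ, k t ζ ≤ ENNReal.ofReal (27 * Real.pi ^ 3 / 2 * R ^ 6) *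
      ENNReal.ofReal (2 / (Real.pi ^ 2 * (1 + ∑ j, ‖ζ j‖ ^ 2) ^ 3)) := by
    intro ζ
    set m := ‖ι ζ‖ with hmdef
    have hmpos : 0 < m := hpos ζ
    have hle : ∀ t, k t ζ ≤ (Metric.closedBall (0 : ℂ) (R / m)).indicator
        (fun _ => ENNReal.ofReal ((R / m) ^ 4)) t := by
      intro t
      by_cases h : (t, ζ) ∈ D
      · have h' : ‖t‖ ≤ R / m := (le_div_iff₀ hmpos).2 h
        simp only [k, Set.indicator_of_mem h]
        rw [Set.indicator_of_mem (by simpa using h')]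
        gcongr
      · simp [k, Set.indicator_of_notMem h]
    have hsum : 1 + ∑ j, ‖ζ j‖ ^ 2 ≤ 3 * m ^ 2 := by
      have h1 : 1 ≤ m := by
        have := norm_le_pi_norm (ι ζ) (Fin.last 2)
        simpa only [hι, Fin.insertNth_apply_same, norm_one] using this
      have h2 : ∀ j, ‖ζ j‖ ≤ m := fun j => by
        have := norm_le_pi_norm (ι ζ) ((Fin.last 2).succAbove j)
        simpa only [hι, Fin.insertNth_apply_succAbove] using this
      have h3 : ∀ j, ‖ζ j‖ ^ 2 ≤ m ^ 2 := fun j => by gcongr; exact h2 j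
      rw [Fin.sum_univ_two]
      nlinarith [h3 0, h3 1]
    have hsum0 : 0 < 1 + ∑ j, ‖ζ j‖ ^ 2 := by positivity
    calc ∫⁻ t : ℂ, k t ζ
        ≤ ∫⁻ t : ℂ, (Metric.closedBall (0 : ℂ) (R / m)).indicator
          (fun _ => ENNReal.ofReal ((R / m) ^ 4)) t := lintegral_mono hle
      _ = ENNReal.ofReal ((R / m) ^ 4 * ((R / m) ^ 2 * Real.pi)) := by
        rw [lintegral_indicator measurableSet_closedBall, setLIntegral_const,
          Complex.volume_closedBall, ENNReal.ofReal_mul (by positivity),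
          ENNReal.ofReal_mul (by positivity), ENNReal.ofReal_pow (p := R / m) (by positivity) 2]
        congr 2
        exact (ENNReal.ofReal_coe_nnreal (p := NNReal.pi)).symm
      _ ≤ ENNReal.ofReal (27 * Real.pi ^ 3 / 2 * R ^ 6 *
          (2 / (Real.pi ^ 2 * (1 + ∑ j, ‖ζ j‖ ^ 2) ^ 3))) := by
        apply ENNReal.ofReal_le_ofReal
        have hpi := Real.pi_pos
        calc (R / m) ^ 4 * ((R / m) ^ 2 * Real.pi)
            = 27 * Real.pi ^ 3 / 2 * R ^ 6 * (2 / (Real.pi ^ 2 * (3 * m ^ 2) ^ 3)) := by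
              field_simp; ring
          _ ≤ _ := by gcongr
      _ = _ := ENNReal.ofReal_mul (by positivity)
  calc volume (cone T ∩ Metric.closedBall 0 R)
      = ∫⁻ t : ℂ, ENNReal.ofReal (‖t‖ ^ 4) *
        volume {ζ : Fin 2 → ℂ | t • ι ζ ∈ cone T ∩ Metric.closedBall 0 R} :=
        volume_eq_lintegral_slices ((measurableSet_cone hT).inter measurableSet_closedBall)
    _ = ∫⁻ t : ℂ, ∫⁻ ζ in T', k t ζ := lintegral_congr_ae (hae.mono hslice)
    _ = ∫⁻ ζ in T', ∫⁻ t : ℂ, k t ζ := lintegral_lintegral_swap hk.aemeasurable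
    _ ≤ ∫⁻ ζ in T', ENNReal.ofReal (27 * Real.pi ^ 3 / 2 * R ^ 6) *
        ENNReal.ofReal (2 / (Real.pi ^ 2 * (1 + ∑ j, ‖ζ j‖ ^ 2) ^ 3)) := lintegral_mono hinner
    _ = ENNReal.ofReal (27 * Real.pi ^ 3 / 2 * R ^ 6) * fsVolume T := by
        rw [lintegral_const_mul' _ _ ENNReal.ofReal_ne_top, fsVolume_apply hT]

/-! ### The derivative of the lift and of its iterates -/

open MvPolynomial in
theorem hasFDerivAt_eval {n : ℕ} (p : MvPolynomial (Fin n) ℂ) (v : Fin n → ℂ) :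
    HasFDerivAt (fun w => eval w p)
      (∑ j, eval v (pderiv j p) • ContinuousLinearMap.proj (R := ℂ) (φ := fun _ : Fin n => ℂ) j)
      v := by
  induction p using MvPolynomial.induction_on with
  | C a =>
    refine ((hasFDerivAt_const a v).congr_fderiv ?_).congr_of_eventuallyEq
      (Eventually.of_forall fun w => eval_C a)
    ext w
    simp
  | add p q hp hq =>
    refine ((hp.add hq).congr_fderiv ?_).congr_of_eventuallyEq
      (Eventually.of_forall fun w => map_add _ p q)
    ext w
    simp [add_mul, Finset.sum_add_distrib]
  | mul_X p i hp =>
    have h := hp.mul (hasFDerivAt_apply (𝕜 := ℂ) i v)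
    refine (h.congr_fderiv ?_).congr_of_eventuallyEq (Eventually.of_forall fun w => by simp)
    ext w
    have hX : ∀ j, eval v (Pi.single (M := fun _ => MvPolynomial (Fin n) ℂ) j 1 i) =
        if i = j then 1 else 0 := fun j => by
      rw [Pi.single_apply]; split_ifs <;> simp
    simp only [_root_.add_apply, _root_.smul_apply,
      ContinuousLinearMap.proj_apply, _root_.sum_apply, smul_eq_mul,
      Derivation.leibniz, pderiv_X, map_add, map_mul, eval_X, hX, add_mul,
      Finset.sum_add_distrib, Finset.mul_sum, mul_ite, ite_mul, mul_one, mul_zero, zero_mul,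
      Finset.sum_ite_eq, Finset.mem_univ, if_true, mul_assoc]

/-- The Jacobian determinant of the lift. -/
noncomputable def HolMap.jacPoly (f : HolMap d) : MvPolynomial (Fin 3) ℂ :=
  Matrix.det (Matrix.of fun i j => MvPolynomial.pderiv j (f.poly i))

/-- The derivative of the lift. -/
noncomputable def HolMap.liftDeriv (f : HolMap d) (v : Fin 3 → ℂ) :
    (Fin 3 → ℂ) →L[ℂ] (Fin 3 → ℂ) :=
  (Matrix.toLin' (Matrix.of fun i j =>
    MvPolynomial.eval v (MvPolynomial.pderiv j (f.poly i)))).toContinuousLinearMap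

theorem HolMap.hasFDerivAt_lift (f : HolMap d) (v : Fin 3 → ℂ) :
    HasFDerivAt f.lift (f.liftDeriv v) v := by
  rw [hasFDerivAt_pi']
  intro i
  refine (hasFDerivAt_eval (f.poly i) v).congr_fderiv ?_
  ext w
  simp [HolMap.liftDeriv, Matrix.mulVec, dotProduct]

theorem HolMap.det_liftDeriv (f : HolMap d) (v : Fin 3 → ℂ) :
    (f.liftDeriv v).det = MvPolynomial.eval v f.jacPoly := by
  rw [HolMap.jacPoly, RingHom.map_det, ContinuousLinearMap.det, HolMap.liftDeriv,
    LinearMap.coe_toContinuousLinearMap, LinearMap.det_toLin']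
  rfl

theorem HolMap.differentiable_lift (f : HolMap d) : Differentiable ℂ f.lift :=
  fun v => (f.hasFDerivAt_lift v).differentiableAt

theorem HolMap.continuous_lift (f : HolMap d) : Continuous f.lift :=
  f.differentiable_lift.continuous

/-- The Jacobian determinant along the orbit under the lift. -/
noncomputable def HolMap.orbitJac (f : HolMap d) (i : ℕ) (v : Fin 3 → ℂ) : ℂ :=
  MvPolynomial.eval (f.lift^[i] v) f.jacPoly

theorem HolMap.differentiable_orbitJac (f : HolMap d) (i : ℕ) :
    Differentiable ℂ (f.orbitJac i) :=
  Differentiable.comp (g := fun w => MvPolynomial.eval w f.jacPoly)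
    (fun w => (hasFDerivAt_eval f.jacPoly w).differentiableAt) (f.differentiable_lift.iterate i)

theorem HolMap.det_fderiv_iterate_lift (f : HolMap d) (n : ℕ) (v : Fin 3 → ℂ) :
    (fderiv ℂ f.lift^[n] v).det = ∏ i ∈ Finset.range n, f.orbitJac i v := by
  induction n with
  | zero => simp [ContinuousLinearMap.det]
  | succ n ih =>
    have h := (f.hasFDerivAt_lift (f.lift^[n] v)).comp v
      ((f.differentiable_lift.iterate n) v).hasFDerivAt
    rw [Function.iterate_succ', h.fderiv, Finset.prod_range_succ, ← ih, mul_comm,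
      HolMap.orbitJac, ← f.det_liftDeriv]
    exact LinearMap.det_comp _ _

/-- The real Jacobian of a complex linear map is the square of the modulus of its determinant. -/
theorem det_restrictScalars_eq_norm_sq (A : (Fin 3 → ℂ) →L[ℂ] (Fin 3 → ℂ)) :
    (A.restrictScalars ℝ).det = ‖A.det‖ ^ 2 := by
  have h : ((A.restrictScalars ℝ : (Fin 3 → ℂ) →L[ℝ] (Fin 3 → ℂ)) :
      (Fin 3 → ℂ) →ₗ[ℝ] (Fin 3 → ℂ)) =
      ((A : (Fin 3 → ℂ) →ₗ[ℂ] (Fin 3 → ℂ))).restrictScalars ℝ := rfl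
  rw [ContinuousLinearMap.det, h, LinearMap.det_restrictScalars, Algebra.norm_complex_apply,
    Complex.normSq_eq_norm_sq]

/-- The Jacobian of the lift is not identically zero, by Sard's theorem, since the lift is
surjective. -/
theorem HolMap.exists_eval_jacPoly_ne_zero (f : HolMap d) (hd : d ≠ 0) :
    ∃ y, MvPolynomial.eval y f.jacPoly ≠ 0 := by
  by_contra! h
  have := addHaar_image_eq_zero_of_det_fderivWithin_eq_zero (volume : Measure (Fin 3 → ℂ))
    (s := Set.univ) (f := f.lift) (f' := fun v => (f.liftDeriv v).restrictScalars ℝ)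
    (fun v _ => ((f.hasFDerivAt_lift v).restrictScalars ℝ).hasFDerivWithinAt)
    (fun v _ => by
      simp only [det_restrictScalars_eq_norm_sq, f.det_liftDeriv, h v, norm_zero]
      norm_num)
  rw [Set.image_univ, (f.lift_surjective hd).range_eq] at this
  exact (isOpen_univ.measure_pos volume Set.univ_nonempty).ne' this

/-! ### Growth of the iterates -/

theorem HolMap.exists_norm_lift_bounds (f : HolMap d) :
    ∃ c C : ℝ, 0 < c ∧ 1 ≤ C ∧ ∀ v ≠ 0, c * ‖v‖ ^ d ≤ ‖f.lift v‖ ∧ ‖f.lift v‖ ≤ C * ‖v‖ ^ d := by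
  have hS : IsCompact (Metric.sphere (0 : Fin 3 → ℂ) 1) := isCompact_sphere _ _
  have hne : (Metric.sphere (0 : Fin 3 → ℂ) 1).Nonempty := NormedSpace.sphere_nonempty.2 zero_le_one
  have hcont := f.continuous_lift.norm.continuousOn (s := Metric.sphere (0 : Fin 3 → ℂ) 1)
  obtain ⟨a, ha, hmin⟩ := hS.exists_isMinOn hne hcont
  obtain ⟨b, -, hmax⟩ := hS.exists_isMaxOn hne hcont
  have ha0 : a ≠ 0 := fun h => by simp [h] at ha
  refine ⟨‖f.lift a‖, max 1 ‖f.lift b‖, norm_pos_iff.2 (f.eval_ne_zero a ha0), le_max_left _ _,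
    fun v hv => ?_⟩
  have hn : 0 < ‖v‖ := norm_pos_iff.2 hv
  set w : Fin 3 → ℂ := ((‖v‖⁻¹ : ℝ) : ℂ) • v
  have hw : w ∈ Metric.sphere (0 : Fin 3 → ℂ) 1 := by
    simp [w, norm_smul, hn.ne']
  have hvw : v = (‖v‖ : ℂ) • w := by
    have : (‖v‖ : ℂ) ≠ 0 := Complex.ofReal_ne_zero.2 hn.ne'
    rw [smul_smul, Complex.ofReal_inv, mul_inv_cancel₀ this, one_smul]
  have hlift : ‖f.lift v‖ = ‖f.lift w‖ * ‖v‖ ^ d := by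
    conv_lhs => rw [hvw, f.lift_smul, norm_smul, norm_pow, Complex.norm_real, norm_norm]
    ring
  rw [hlift]
  exact ⟨by gcongr; exact hmin hw, by gcongr; exact (hmax hw).trans (le_max_right _ _)⟩

theorem HolMap.lift_ne_zero (f : HolMap d) {v : Fin 3 → ℂ} (hv : v ≠ 0) : f.lift v ≠ 0 :=
  f.eval_ne_zero v hv

theorem HolMap.exists_norm_iterate_le (f : HolMap d) (hd : 2 ≤ d) (R : ℝ) :
    ∃ Q : ℝ, 1 ≤ Q ∧ ∀ n v, ‖v‖ ≤ R → ‖f.lift^[n] v‖ ≤ Q ^ d ^ n := by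
  obtain ⟨c, C, -, hC, h⟩ := f.exists_norm_lift_bounds
  have hle : ∀ v, ‖f.lift v‖ ≤ C * ‖v‖ ^ d := fun v => by
    by_cases hv : v = 0
    · rw [hv, f.lift_zero (by omega), norm_zero]; positivity
    · exact (h v hv).2
  have hQ : 1 ≤ C * max R 1 := one_le_mul_of_one_le_of_one_le hC (le_max_right _ _)
  refine ⟨C * max R 1, hQ, fun n v hv => ?_⟩
  -- The factor `C` on the left absorbs the constant in the induction, as `2 ≤ d`.
  have key : C * ‖f.lift^[n] v‖ ≤ (C * max R 1) ^ d ^ n := by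
    induction n with
    | zero =>
      simp only [Function.iterate_zero, id_eq, pow_zero, pow_one]
      gcongr
      exact hv.trans (le_max_left _ _)
    | succ n ih =>
      rw [Function.iterate_succ_apply']
      calc C * ‖f.lift (f.lift^[n] v)‖ ≤ C * (C * ‖f.lift^[n] v‖ ^ d) := by
            gcongr; exact hle _
        _ = C ^ 2 * ‖f.lift^[n] v‖ ^ d := by ring
        _ ≤ C ^ d * ‖f.lift^[n] v‖ ^ d := by gcongr
        _ = (C * ‖f.lift^[n] v‖) ^ d := (mul_pow _ _ _).symm
        _ ≤ ((C * max R 1) ^ d ^ n) ^ d := by gcongr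
        _ = _ := by rw [← pow_mul, pow_succ]
  exact (le_mul_of_one_le_left (norm_nonneg _) hC).trans key

/-- Iterated preimages of a point stay in a bounded region. -/
theorem HolMap.exists_norm_le_of_iterate_eq (f : HolMap d) (hd : 2 ≤ d) (y : Fin 3 → ℂ) :
    ∃ ρ : ℝ, 0 ≤ ρ ∧ ∀ n v, f.lift^[n] v = y → ‖v‖ ≤ ρ := by
  obtain ⟨c, C, hc, -, h⟩ := f.exists_norm_lift_bounds
  set ρ := max (max 1 c⁻¹) ‖y‖
  have hρ1 : 1 ≤ ρ := (le_max_left _ _).trans (le_max_left _ _)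
  -- Outside the ball of radius `ρ ≥ max 1 (1 / c)` the lift does not decrease the norm.
  have hstep : ∀ v, ρ < ‖v‖ → ρ < ‖f.lift v‖ := by
    intro v hv
    have hv1 : 1 ≤ ‖v‖ := hρ1.trans hv.le
    have hv0 : v ≠ 0 := norm_pos_iff.1 (by linarith)
    have hcv : 1 ≤ c * ‖v‖ := by
      have : c⁻¹ ≤ ‖v‖ := ((le_max_right _ _).trans (le_max_left _ _)).trans hv.le
      calc 1 = c * c⁻¹ := (mul_inv_cancel₀ hc.ne').symm
        _ ≤ _ := by gcongr
    calc ρ < ‖v‖ := hv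
      _ ≤ c * ‖v‖ * ‖v‖ := le_mul_of_one_le_left (norm_nonneg _) hcv
      _ = c * ‖v‖ ^ 2 := by ring
      _ ≤ c * ‖v‖ ^ d := by gcongr
      _ ≤ _ := (h v hv0).1
  refine ⟨ρ, zero_le_one.trans hρ1, fun n v hv => ?_⟩
  by_contra! hlt
  have : ∀ n, ρ < ‖f.lift^[n] v‖ := fun n => by
    induction n with
    | zero => exact hlt
    | succ n ih => rw [Function.iterate_succ_apply']; exact hstep _ ih
  have h1 := this n
  rw [hv] at h1
  exact not_lt.2 (le_max_right _ _) h1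

open MvPolynomial in
theorem exists_norm_eval_le {n : ℕ} (p : MvPolynomial (Fin n) ℂ) :
    ∃ (C : ℝ) (k : ℕ), 1 ≤ C ∧ ∀ v, ‖eval v p‖ ≤ C * (1 + ‖v‖) ^ k := by
  induction p using MvPolynomial.induction_on with
  | C a => exact ⟨max 1 ‖a‖, 0, le_max_left _ _, fun v => by simp⟩
  | add p q hp hq =>
    obtain ⟨C, k, hC, h⟩ := hp
    obtain ⟨C', k', hC', h'⟩ := hq
    refine ⟨C + C', max k k', by linarith, fun v => ?_⟩
    have h1 : 1 ≤ 1 + ‖v‖ := by linarith [norm_nonneg v]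
    rw [map_add, add_mul]
    refine (norm_add_le _ _).trans (add_le_add ((h v).trans ?_) ((h' v).trans ?_))
    · gcongr
      exact le_max_left _ _
    · gcongr
      exact le_max_right _ _
  | mul_X p i hp =>
    obtain ⟨C, k, hC, h⟩ := hp
    refine ⟨C, k + 1, hC, fun v => ?_⟩
    rw [map_mul, eval_X, norm_mul, pow_succ, ← mul_assoc]
    gcongr
    · exact h v
    · linarith [norm_le_pi_norm v i]

theorem HolMap.exists_norm_orbitJac_le (f : HolMap d) (hd : 2 ≤ d) (R : ℝ) :
    ∃ b : ℝ, 0 ≤ b ∧ ∀ i v, ‖v‖ ≤ R → ‖f.orbitJac i v‖ ≤ Real.exp (d ^ i * b) := by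
  obtain ⟨Q, hQ, hiter⟩ := f.exists_norm_iterate_le hd R
  obtain ⟨C, k, hC, hJ⟩ := exists_norm_eval_le f.jacPoly
  have hB : 1 ≤ C * (2 * Q) ^ k := one_le_mul_of_one_le_of_one_le hC (one_le_pow₀ (by linarith))
  refine ⟨Real.log (C * (2 * Q) ^ k), Real.log_nonneg hB, fun i v hv => ?_⟩
  have hdi : d ^ i ≠ 0 := pow_ne_zero _ (by omega)
  have hexp : Real.exp (d ^ i * Real.log (C * (2 * Q) ^ k)) = (C * (2 * Q) ^ k) ^ d ^ i := by
    have := Real.exp_nat_mul (Real.log (C * (2 * Q) ^ k)) (d ^ i)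
    rw [Real.exp_log (by linarith)] at this
    rw [← this]
    push_cast
    rfl
  rw [hexp]
  have hone : 1 ≤ Q ^ d ^ i := one_le_pow₀ hQ
  calc ‖f.orbitJac i v‖ ≤ C * (1 + ‖f.lift^[i] v‖) ^ k := hJ _
    _ ≤ C * (2 * Q ^ d ^ i) ^ k := by
      gcongr
      linarith [hiter i v hv]
    _ ≤ C ^ d ^ i * ((2 * Q) ^ d ^ i) ^ k := by
      rw [mul_pow 2 Q]
      gcongr
      · exact le_self_pow₀ hC hdi
      · exact le_self_pow₀ one_le_two hdi
    _ = _ := by rw [mul_pow C, ← pow_mul, ← pow_mul, mul_comm k]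

/-! ### Volume of the iterated images -/

theorem sum_pow_le_pow (hd : 2 ≤ d) (n : ℕ) :
    ∑ i ∈ Finset.range n, (d : ℝ) ^ i ≤ (d : ℝ) ^ n := by
  have hd' : (2 : ℝ) ≤ d := by exact_mod_cast hd
  induction n with
  | zero => simp
  | succ n ih =>
    rw [Finset.sum_range_succ, pow_succ]
    have : (0 : ℝ) ≤ (d : ℝ) ^ n := by positivity
    nlinarith

/-- The mean of `-log |J ∘ F^i|` over a ball, with `J` the Jacobian determinant of the lift `F`,
grows at most like `d ^ i`. As the lift is surjective, there are points of a bounded region that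
`F^i` maps to a fixed noncritical point; the mean value inequality is used there. -/
theorem HolMap.exists_integral_orbitJac_le (f : HolMap d) (hd : 2 ≤ d) (R : ℝ) :
    ∃ b C : ℝ, 0 ≤ b ∧ 0 < C ∧
      (∀ i v, ‖v‖ ≤ R → ‖f.orbitJac i v‖ ≤ Real.exp (d ^ i * b)) ∧
      ∀ i, ∀ ε : ℝ, 0 < ε → ε ≤ 1 → ∫ v in Metric.closedBall 0 R,
        (d ^ i * b - Real.log (max ‖f.orbitJac i v‖ ε)) ≤ C * d ^ i := by
  have hd0 : d ≠ 0 := by omega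
  obtain ⟨y, hy⟩ := f.exists_eval_jacPoly_ne_zero hd0
  obtain ⟨ρ, hρ, hpre⟩ := f.exists_norm_le_of_iterate_eq hd y
  obtain ⟨b, hb, hJ⟩ := f.exists_norm_orbitJac_le hd (R + 2 * ρ)
  set δ := Real.log ‖MvPolynomial.eval y f.jacPoly‖
  set V := volume.real (Metric.closedBall (0 : Fin 3 → ℂ) (R + ρ))
  have hV : 0 ≤ V := measureReal_nonneg
  refine ⟨b, V * (b + |δ|) + 1, hb, by positivity, fun i v hv => hJ i v (by linarith),
    fun i ε hε hε1 => ?_⟩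
  obtain ⟨x, hx⟩ := (f.lift_surjective hd0).iterate i y
  have hxρ := hpre i x hx
  have hdi : (1 : ℝ) ≤ (d : ℝ) ^ i := one_le_pow₀ (by exact_mod_cast (by omega : 1 ≤ d))
  have hGx : f.orbitJac i x = MvPolynomial.eval y f.jacPoly := by rw [HolMap.orbitJac, hx]
  have hsub : Metric.closedBall (0 : Fin 3 → ℂ) R ⊆ Metric.closedBall x (R + ρ) := by
    refine Metric.closedBall_subset_closedBall' ?_
    rw [dist_zero_left]; linarith
  have hmain := integral_sub_log_max_le (f.differentiable_orbitJac i) (x₀ := x)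
    (by rw [hGx]; exact hy) (M := d ^ i * b) hsub hε
    (hε1.trans (Real.one_le_exp (by positivity))) (fun v hv => hJ i v (by
      have h1 : ‖v - x‖ ≤ R + ρ := by simpa [dist_eq_norm] using hv
      have h2 := norm_sub_norm_le v x
      linarith))
  have hvol : volume.real (Metric.closedBall x (R + ρ)) = V := by
    simp only [V, Measure.real, Measure.addHaar_closedBall_center]
  rw [hvol, hGx] at hmain
  refine hmain.trans ?_
  have h1 : -δ ≤ |δ| * (d : ℝ) ^ i :=
    (neg_le_abs δ).trans (le_mul_of_one_le_right (abs_nonneg _) hdi)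
  calc V * (d ^ i * b - δ) ≤ V * (d ^ i * b + |δ| * d ^ i) := by gcongr; linarith
    _ = V * (b + |δ|) * d ^ i := by ring
    _ ≤ (V * (b + |δ|) + 1) * d ^ i := by gcongr; linarith

/-- A bounded set of positive measure contains a subset of at least half its measure on which the
Jacobian of the `n`-th iterate of the lift is bounded below by `exp (- C d ^ n)`. -/
theorem HolMap.exists_subset_le_norm_det (f : HolMap d) (hd : 2 ≤ d) {R : ℝ}
    {E : Set (Fin 3 → ℂ)} (hE : MeasurableSet E) (hER : E ⊆ Metric.closedBall 0 R)
    (hpos : 0 < volume.real E) :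
    ∃ τ : ℝ, 0 < τ ∧ ∀ n : ℕ, ∃ A ⊆ E, MeasurableSet A ∧ volume.real E / 2 ≤ volume.real A ∧
      ∀ v ∈ A, Real.exp (-(τ * d ^ n)) ≤ ‖(fderiv ℂ f.lift^[n] v).det‖ := by
  obtain ⟨b, C, hb, hC, hup, hint⟩ := f.exists_integral_orbitJac_le hd R
  set m := volume.real E
  refine ⟨2 * C / m, by positivity, fun n => ?_⟩
  have hd1 : (1 : ℝ) ≤ d := by exact_mod_cast (by omega : 1 ≤ d)
  have hdn : 0 < (d : ℝ) ^ n := by positivity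
  set T := 2 * C / m * d ^ n with hT
  have hTpos : 0 < T := by positivity
  -- On the subset where the sum `g` of the truncated terms is less than `T`, every factor of the
  -- Jacobian exceeds this level, so that the truncation has no effect there.
  set ε := Real.exp (-T) with hε
  have hε0 : 0 < ε := Real.exp_pos _
  have hε1 : ε ≤ 1 := Real.exp_le_one_iff.2 (by linarith)
  let h : ℕ → (Fin 3 → ℂ) → ℝ := fun i v => d ^ i * b - Real.log (max ‖f.orbitJac i v‖ ε)
  let g : (Fin 3 → ℂ) → ℝ := fun v => ∑ i ∈ Finset.range n, h i v
  have hcont : ∀ i, Continuous (h i) := fun i => by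
    refine continuous_const.sub (Continuous.log ?_ fun z => (lt_max_of_lt_right hε0).ne')
    exact (f.differentiable_orbitJac i).continuous.norm.max continuous_const
  have hgcont : Continuous g := continuous_finsetSum _ fun i _ => hcont i
  have hh0 : ∀ i, ∀ v ∈ Metric.closedBall 0 R, 0 ≤ h i v := fun i v hv => by
    rw [sub_nonneg, Real.log_le_iff_le_exp (lt_max_of_lt_right hε0)]
    exact max_le (hup i v (by simpa using hv)) (hε1.trans (Real.one_le_exp (by positivity)))
  have hg0 : ∀ v ∈ Metric.closedBall 0 R, 0 ≤ g v := fun v hv =>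
    Finset.sum_nonneg fun i _ => hh0 i v hv
  have hgi : IntegrableOn g (Metric.closedBall 0 R) :=
    hgcont.continuousOn.integrableOn_compact (isCompact_closedBall _ _)
  have hgint : ∫ v in E, g v ≤ C * d ^ n :=
    calc ∫ v in E, g v ≤ ∫ v in Metric.closedBall 0 R, g v :=
          setIntegral_mono_set hgi ((ae_restrict_mem measurableSet_closedBall).mono hg0)
            hER.eventuallyLE
      _ = ∑ i ∈ Finset.range n, ∫ v in Metric.closedBall 0 R, h i v :=
          integral_finsetSum _ fun i _ =>
            (hcont i).continuousOn.integrableOn_compact (isCompact_closedBall _ _)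
      _ ≤ ∑ i ∈ Finset.range n, C * d ^ i := Finset.sum_le_sum fun i _ => hint i ε hε0 hε1
      _ ≤ C * d ^ n := by
          rw [← Finset.mul_sum]; gcongr; exact sum_pow_le_pow hd n
  have hbad : MeasurableSet {v | T ≤ g v} := measurableSet_le measurable_const hgcont.measurable
  -- By Markov's inequality, `g` is at least twice its mean bound on at most half of `E`.
  have hmarkov := mul_meas_ge_le_integral_of_nonneg (μ := volume.restrict E) (f := g)
    ((ae_restrict_mem hE).mono fun v hv => hg0 v (hER hv)) (hgi.mono_set hER) T
  have hEfin : volume E ≠ ⊤ :=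
    ((measure_mono hER).trans_lt measure_closedBall_lt_top).ne
  have hbadm : volume.real (E ∩ {v | T ≤ g v}) ≤ m / 2 := by
    have h1 : (volume.restrict E).real {v | T ≤ g v} = volume.real (E ∩ {v | T ≤ g v}) := by
      rw [measureReal_restrict_apply hbad, Set.inter_comm]
    rw [h1] at hmarkov
    have h2 : T * volume.real (E ∩ {v | T ≤ g v}) ≤ T * (m / 2) := by
      refine (hmarkov.trans hgint).trans (le_of_eq ?_)
      rw [hT]; field_simp
    exact le_of_mul_le_mul_left h2 hTpos
  refine ⟨E \ {v | T ≤ g v}, Set.sdiff_subset, hE.diff hbad, ?_, fun v hv => ?_⟩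
  · have := measureReal_inter_add_sdiff (μ := volume) (s := E) hbad hEfin
    linarith
  · have hvR := hER hv.1
    have hgT : g v < T := not_le.1 hv.2
    have hlarge : ∀ i ∈ Finset.range n, ε < ‖f.orbitJac i v‖ := fun i hi => by
      have h1 : h i v ≤ g v := Finset.single_le_sum (f := fun i => h i v)
        (fun j _ => hh0 j v hvR) hi
      have h2 : -T < Real.log (max ‖f.orbitJac i v‖ ε) := by
        have h3 : 0 ≤ (d : ℝ) ^ i * b := by positivity
        have h4 : h i v = d ^ i * b - Real.log (max ‖f.orbitJac i v‖ ε) := rfl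
        linarith
      rw [Real.lt_log_iff_exp_lt (lt_max_of_lt_right hε0)] at h2
      exact (lt_max_iff.1 h2).resolve_right (lt_irrefl _)
    have hlog : -T ≤ ∑ i ∈ Finset.range n, Real.log ‖f.orbitJac i v‖ := by
      have h1 : g v = ∑ i ∈ Finset.range n, ((d : ℝ) ^ i * b - Real.log ‖f.orbitJac i v‖) :=
        Finset.sum_congr rfl fun i hi => by
          simp only [h, max_eq_left (hlarge i hi).le]
      have h2 : 0 ≤ ∑ i ∈ Finset.range n, (d : ℝ) ^ i * b :=
        Finset.sum_nonneg fun i _ => by positivity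
      rw [Finset.sum_sub_distrib] at h1
      linarith
    have hne : ∀ i ∈ Finset.range n, ‖f.orbitJac i v‖ ≠ 0 := fun i hi =>
      (hε0.trans (hlarge i hi)).ne'
    rw [← Real.log_prod hne] at hlog
    rw [f.det_fderiv_iterate_lift, norm_prod]
    exact (Real.le_log_iff_exp_le (Finset.prod_pos fun i hi => hε0.trans (hlarge i hi))).1 hlog

/-- The volume estimate for the lift: the area formula is applied to the subset on which the
Jacobian is bounded below. -/
theorem HolMap.exists_pow_le_volume_image_lift (f : HolMap d) (hd : 2 ≤ d) {R : ℝ}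
    {E : Set (Fin 3 → ℂ)} (hE : MeasurableSet E) (hER : E ⊆ Metric.closedBall 0 R)
    (hpos : 0 < volume E) :
    ∃ γ : ℝ, 0 < γ ∧ ∀ n : ℕ, ENNReal.ofReal (γ ^ d ^ n) ≤ volume (f.lift^[n] '' E) := by
  have hEfin : volume E ≠ ⊤ :=
    ((measure_mono hER).trans_lt measure_closedBall_lt_top).ne
  have hm : 0 < volume.real E := ENNReal.toReal_pos hpos.ne' hEfin
  obtain ⟨τ, hτ, hA⟩ := f.exists_subset_le_norm_det hd hE hER hm
  obtain ⟨N₀, hN₀⟩ := f.exists_encard_fibre_le (by omega)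
  -- The bound is made positive, because it is divided by below.
  set N := N₀ + 1
  have hN : ∀ y, (f.lift ⁻¹' {y}).encard ≤ N := fun y =>
    (hN₀ y).trans (by exact_mod_cast Nat.le_succ _)
  have hN1 : (1 : ℝ) ≤ N := by simp [N]
  set a := min (volume.real E / 2) 1
  have ha : 0 < a := lt_min (by positivity) one_pos
  refine ⟨a * Real.exp (-(2 * τ)) / N, by positivity, fun n => ?_⟩
  obtain ⟨A, hAE, hAm, hAvol, hdet⟩ := hA n
  have hdn : d ^ n ≠ 0 := pow_ne_zero _ (by omega)
  have hdiff : Differentiable ℂ f.lift^[n] := f.differentiable_lift.iterate n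
  have hg : ∀ x, HasFDerivAt f.lift^[n] ((fderiv ℂ f.lift^[n] x).restrictScalars ℝ) x :=
    fun x => (hdiff x).hasFDerivAt.restrictScalars ℝ
  have hdetm : Measurable fun x => ((fderiv ℂ f.lift^[n] x).restrictScalars ℝ).det := by
    simp only [det_restrictScalars_eq_norm_sq, f.det_fderiv_iterate_lift]
    refine Continuous.measurable (Continuous.pow (Continuous.norm ?_) 2)
    exact continuous_finsetProd _ fun i _ => (f.differentiable_orbitJac i).continuous
  have harea := lintegral_abs_det_fderiv_le_mul_measure_image volume hg hdetm
    (encard_preimage_iterate_le hN n) hAm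
  have hlow : ENNReal.ofReal (a ^ d ^ n * Real.exp (-(2 * τ)) ^ d ^ n) ≤
      ((N ^ n : ℕ) : ENNReal) * volume (f.lift^[n] '' A) := by
    refine le_trans ?_ harea
    have hexp : Real.exp (-(2 * τ)) ^ d ^ n = Real.exp (-(τ * d ^ n)) ^ 2 := by
      rw [← Real.exp_nat_mul, ← Real.exp_nat_mul]
      congr 1
      push_cast
      ring
    have hAfin : volume A ≠ ⊤ := ((measure_mono hAE).trans_lt hEfin.lt_top).ne
    calc ENNReal.ofReal (a ^ d ^ n * Real.exp (-(2 * τ)) ^ d ^ n)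
        ≤ ENNReal.ofReal (volume.real A * Real.exp (-(τ * d ^ n)) ^ 2) := by
          rw [hexp]
          gcongr
          calc a ^ d ^ n ≤ a := pow_le_of_le_one ha.le (min_le_right _ _) hdn
            _ ≤ _ := (min_le_left _ _).trans hAvol
      _ = ∫⁻ _ in A, ENNReal.ofReal (Real.exp (-(τ * d ^ n)) ^ 2) := by
          rw [setLIntegral_const, mul_comm, ENNReal.ofReal_mul (by positivity),
            Measure.real, ENNReal.ofReal_toReal hAfin]
      _ ≤ _ := by
          refine setLIntegral_mono' hAm fun v hv => ENNReal.ofReal_le_ofReal ?_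
          rw [det_restrictScalars_eq_norm_sq, abs_of_nonneg (by positivity)]
          gcongr
          exact hdet v hv
  have hNn : (0 : ENNReal) < ((N ^ n : ℕ) : ENNReal) := by
    exact_mod_cast pow_pos (Nat.succ_pos _) n
  have hNtop : ((N ^ n : ℕ) : ENNReal) ≠ ⊤ := ENNReal.natCast_ne_top _
  have hnd : n ≤ d ^ n := (Nat.lt_pow_self (by omega)).le
  refine le_trans ?_ (measure_mono (Set.image_mono hAE))
  refine (ENNReal.mul_le_mul_iff_right hNn.ne' hNtop).1 (le_trans ?_ hlow)
  rw [← ENNReal.ofReal_natCast, ← ENNReal.ofReal_mul (by positivity)]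
  apply ENNReal.ofReal_le_ofReal
  rw [div_pow, mul_pow, Nat.cast_pow, mul_div_assoc', div_le_iff₀ (by positivity), mul_comm]
  gcongr

theorem HolMap.map_iterate_mk (f : HolMap d) (n : ℕ) {v : Fin 3 → ℂ} (hv : v ≠ 0) :
    ∃ h : f.lift^[n] v ≠ 0,
      f.map^[n] (Projectivization.mk ℂ v hv) = Projectivization.mk ℂ (f.lift^[n] v) h := by
  induction n with
  | zero => exact ⟨hv, rfl⟩
  | succ n ih =>
    obtain ⟨h, ih⟩ := ih
    rw [Function.iterate_succ_apply', Function.iterate_succ_apply', ih]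
    exact ⟨f.lift_ne_zero h, f.map_mk _ h⟩

theorem HolMap.image_cone_subset (f : HolMap d) (n : ℕ) (E : Set P2) :
    f.lift^[n] '' cone E ⊆ cone (f.map^[n] '' E) := by
  rintro _ ⟨v, ⟨hv, hvE⟩, rfl⟩
  obtain ⟨h, hmap⟩ := f.map_iterate_mk n hv
  exact ⟨h, _, hvE, hmap⟩

/-- The volume estimate in the plane, valid for every Borel set of positive volume. It is the
estimate for the lift, applied to a bounded part of the cone over `E`; the radius of a ball that
contains the image of this part is at most `Q ^ d ^ n`. -/
theorem HolMap.exists_pow_le_fsVolume_image (f : HolMap d) (hd : 2 ≤ d) {E : Set P2}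
    (hE : MeasurableSet E) (hpos : 0 < fsVolume E) :
    ∃ γ : ℝ, 0 < γ ∧ ∀ n : ℕ, ENNReal.ofReal (γ ^ d ^ n) ≤ fsVolume (f.map^[n] '' E) := by
  have hcone := volume_cone_pos hE hpos
  obtain ⟨R, hRpos⟩ : ∃ R : ℕ, 0 < volume (cone E ∩ Metric.closedBall 0 (R : ℝ)) := by
    by_contra! h
    refine hcone.ne' ?_
    rw [← Metric.iUnion_inter_closedBall_nat (cone E) 0]
    exact measure_iUnion_null fun R => nonpos_iff_eq_zero.1 (h R)
  obtain ⟨γ, hγ, himage⟩ := f.exists_pow_le_volume_image_lift hd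
    ((measurableSet_cone hE).inter measurableSet_closedBall) Set.inter_subset_right hRpos
  obtain ⟨Q, hQ, hiter⟩ := f.exists_norm_iterate_le hd R
  set K := 27 * Real.pi ^ 3 / 2
  have hK : 1 ≤ K := by
    have h3 := Real.pi_gt_three
    have : (3 : ℝ) ^ 3 ≤ Real.pi ^ 3 := by gcongr
    simp only [K]
    linarith
  refine ⟨γ / (K * Q ^ 6), by positivity, fun n => ?_⟩
  have hdn : d ^ n ≠ 0 := pow_ne_zero _ (by omega)
  set r := Q ^ d ^ n
  have hr : 0 < r := by positivity
  have hsub : f.lift^[n] '' (cone E ∩ Metric.closedBall 0 (R : ℝ)) ⊆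
      cone (f.map^[n] '' E) ∩ Metric.closedBall 0 r := by
    rintro _ ⟨v, ⟨hv, hvR⟩, rfl⟩
    exact ⟨f.image_cone_subset n E ⟨v, hv, rfl⟩,
      by simpa using hiter n v (by simpa using hvR)⟩
  have h1 : ENNReal.ofReal (γ ^ d ^ n) ≤
      ENNReal.ofReal (K * r ^ 6) * fsVolume (f.map^[n] '' E) :=
    (himage n).trans ((measure_mono hsub).trans (volume_cone_inter_closedBall_le _ hr.le))
  have hpos' : 0 < K * r ^ 6 := by positivity
  refine (ENNReal.mul_le_mul_iff_right (ENNReal.ofReal_pos.2 hpos').ne'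
    ENNReal.ofReal_ne_top).1 (le_trans ?_ h1)
  rw [← ENNReal.ofReal_mul hpos'.le]
  apply ENNReal.ofReal_le_ofReal
  rw [div_pow, mul_div_assoc', div_le_iff₀ (by positivity), mul_comm]
  gcongr
  calc K * r ^ 6 ≤ K ^ d ^ n * r ^ 6 := by gcongr; exact le_self_pow₀ hK hdn
    _ = (K * Q ^ 6) ^ d ^ n := by rw [mul_pow, ← pow_mul, ← pow_mul, mul_comm 6]

end HolP2

theorem mainTheorem12 (d : ℕ) (hd : 2 ≤ d) (f : HolP2.HolMap d)
    (hhom : ∀ q ∈ f.excTwo \ f.excOne, f.IsHomogeneousPoint q)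
    (p : HolP2.P2) (hp : p ∈ f.excTwo) :
    ∃ Ω ∈ 𝓝 p, ∀ E : Set HolP2.P2, E ⊆ Ω → MeasurableSet E → 0 < HolP2.fsVolume E →
      ∃ γ : ℝ, 0 < γ ∧
        ∀ n : ℕ, ENNReal.ofReal (γ ^ (d ^ n)) ≤ HolP2.fsVolume (f.map^[n] '' E) :=
  ⟨Set.univ, Filter.univ_mem, fun _ _ hE hpos => f.exists_pow_le_fsVolume_image hd hE hpos⟩
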